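/- All quantum systems are finite-dimensional (of nonzero dimension), states are density matrices and Hamiltonians are Hermitian matrices. For a Hamiltonian $H$ and a real $b$ let $\gamma_b^{\mathrm{Gibbs}}(H)=e^{-bH}/\operatorname{tr}(e^{-bH})$. For real $e$ let $[e]_H$ be the set of density matrices $\rho$ with $\operatorname{tr}(\rho H)=e$. If $[e]_H$ is non-empty, the canonical ensemble $\gamma_e(H)$ of the macrostate $(e,H)$ is the Gibbs state of $H$ of mean energy $e$; if $H$ is not a multiple of the identity and $e$ is its smallest or largest eigenvalue, it is the limit of $\gamma_b^{\mathrm{Gibbs}}(H)$ as $b\to+\infty$ or $b\to-\infty$, respectively. Fix a real $\beta$. An environment is a finite family of systems $E^1,\dots,E^N$ of arbitrary dimensions with arbitrary Hamiltonians $H_{E^i}$; write $e_\beta(H_{E^i})=\operatorname{tr}\big(\gamma_\beta^{\mathrm{Gibbs}}(H_{E^i})H_{E^i}\big)$ and $H_{SE}=H\otimes 1+1\otimes\sum_i H_{E^i}$, where $H_{E^i}$ acts on the $i$-th tensor factor of the environment. A state $\rho_f$ of the system $S$ can be reached by macrostate operations from $(e,H)$, written $(e,H)\overset{\beta\text{-mac}}{\longrightarrow}\rho_f$,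 if for all $\epsilon,\epsilon'>0$ there are an environment and a unitary $U$ on $SE$ such that for every $\rho\in[e]_H$ and all $\rho_{E^i}\in[e_\beta(H_{E^i})]_{H_{E^i}}$, with $\rho_{SE}=\rho\otimes\rho_{E^1}\otimes\dots\otimes\rho_{E^N}$, $$\big\|\rho_f-\operatorname{tr}_E(U\rho_{SE}U^\dagger)\big\|_1\le\epsilon,\qquad \big|\operatorname{tr}(U\rho_{SE}U^\dagger H_{SE})-\operatorname{tr}(\rho_{SE}H_{SE})\big|\le\epsilon' .$$ A state $\rho_f$ can be reached by microstate operations from a state $\rho$ of $S$, written $\rho\overset{\beta\text{-mic}}{\longrightarrow}\rho_f$, if for all $\epsilon,\epsilon'>0$ there are an environment and a unitary $U$ on $SE$ such that these two inequalities hold for the single state $\rho_{SE}=\rho\otimes\gamma_\beta^{\mathrm{Gibbs}}(H_{E^1})\otimes\dots\otimes\gamma_\beta^{\mathrm{Gibbs}}(H_{E^N})$. Theorem (Equivalence with the canonical ensemble). Let $\beta\neq0$ and let $(e,H)$ be a macrostate of $S$ with $[e]_H\neq\emptyset$. Then the canonical ensemble $\gamma_e(H)$ exists and $(e,H)\sim_\beta\gamma_e(H)$,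 that is, for every state $\rho_f$ of $S$, $$(e,H)\overset{\beta\text{-mac}}{\longrightarrow}\rho_f\iff\gamma_e(H)\overset{\beta\text{-mic}}{\longrightarrow}\rho_f .$$ -/

import Mathlib

open scoped ComplexOrder Kronecker Matrix Topology
open Filter

/-- `ρ` is a density matrix: positive semidefinite of trace one. -/
def IsDensityMatrix {n : Type*} [Fintype n] (ρ : Matrix n n ℂ) : Prop :=
  ρ.PosSemidef ∧ ρ.trace = 1

/-- The mean energy `tr (ρ H)` of `ρ` with respect to the Hamiltonian `H`
(a real number when `ρ` and `H` are Hermitian). -/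
noncomputable def meanEnergy {n : Type*} [Fintype n] (H ρ : Matrix n n ℂ) : ℝ :=
  (ρ * H).trace.re

/-- The equivalence class `[e]_H` of the macrostate `(e, H)`: all density matrices of mean
energy `e` with respect to `H`. -/
def microstates {n : Type*} [Fintype n] (e : ℝ) (H : Matrix n n ℂ) : Set (Matrix n n ℂ) :=
  {ρ | IsDensityMatrix ρ ∧ meanEnergy H ρ = e}

/-- The Gibbs state `exp (-b H) / tr (exp (-b H))` at inverse temperature `b`. -/
noncomputable def gibbs {n : Type*} [Fintype n] [DecidableEq n] (b : ℝ) (H : Matrix n n ℂ) :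
    Matrix n n ℂ :=
  (NormedSpace.exp (-(b : ℂ) • H)).trace⁻¹ • NormedSpace.exp (-(b : ℂ) • H)

/-- The thermal energy `e_β(H)`: the mean energy of the Gibbs state at inverse temperature `β`. -/
noncomputable def thermalEnergy {n : Type*} [Fintype n] [DecidableEq n] (β : ℝ)
    (H : Matrix n n ℂ) : ℝ :=
  meanEnergy H (gibbs β H)

/-- `γ` is the canonical ensemble `γ_e(H)` of the macrostate `(e, H)`: the Gibbs state of mean
energy `e`, at an inverse temperature in `[-∞, ∞]`. The values `±∞`, read as limits of Gibbs
states, occur when `e` is the least or the greatest eigenvalue of `H` and `H` is not a scalar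
matrix; for all other attainable `e` the inverse temperature is a real number. -/
def IsCanonicalEnsemble {n : Type*} [Fintype n] [DecidableEq n] (e : ℝ) (H γ : Matrix n n ℂ) :
    Prop :=
  meanEnergy H γ = e ∧
    ((∃ b : ℝ, γ = gibbs b H) ∨ Tendsto (fun b : ℝ => gibbs b H) atTop (𝓝 γ) ∨
      Tendsto (fun b : ℝ => gibbs b H) atBot (𝓝 γ))

/-- The trace norm `‖A‖₁ = tr √(Aᴴ A)`, the sum of the singular values of `A`. -/
noncomputable def traceNorm {n : Type*} [Fintype n] [DecidableEq n] (A : Matrix n n ℂ) : ℝ :=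
  ∑ i, Real.sqrt ((Matrix.isHermitian_conjTranspose_mul_self A).eigenvalues i)

/-- The partial trace over the second tensor factor. -/
def partialTrace {m n : Type*} [Fintype n] (A : Matrix (m × n) (m × n) ℂ) : Matrix m m ℂ :=
  Matrix.of fun i j => ∑ k, A (i, k) (j, k)

/-- The tensor product of a finite family of matrices, acting on the tensor product of the
factors (with the product basis). -/
def tensorProd {ι : Type*} [Fintype ι] {X : ι → Type*}
    (A : ∀ i, Matrix (X i) (X i) ℂ) : Matrix (∀ i, X i) (∀ i, X i) ℂ :=
  Matrix.of fun x y => ∏ i, A i (x i) (y i)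

/-- An environment: finitely many quantum systems of finite nonzero dimension (an orthonormal
basis of system `i` is labelled by `X i`), each with its own Hamiltonian. -/
structure Environment where
  /-- labels of the systems -/
  ι : Type
  [fintypeLabel : Fintype ι]
  [decEqLabel : DecidableEq ι]
  /-- labels of an orthonormal basis of each system -/
  X : ι → Type
  [fintypeBasis : ∀ i, Fintype (X i)]
  [decEqBasis : ∀ i, DecidableEq (X i)]
  [nonemptyBasis : ∀ i, Nonempty (X i)]
  /-- the Hamiltonian of each system -/
  ham : ∀ i, Matrix (X i) (X i) ℂ
  isHermitian_ham : ∀ i, (ham i).IsHermitian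

attribute [instance] Environment.fintypeLabel Environment.decEqLabel Environment.fintypeBasis
  Environment.decEqBasis Environment.nonemptyBasis

/-- The basis labels of the whole environment. -/
abbrev Environment.Basis (E : Environment) : Type := ∀ i, E.X i

/-- The Hamiltonian of the environment: the sum over its systems of
`1 ⊗ ⋯ ⊗ H_i ⊗ ⋯ ⊗ 1`. -/
noncomputable def Environment.totalHam (E : Environment) : Matrix E.Basis E.Basis ℂ :=
  ∑ i, tensorProd
    (Function.update (fun j => (1 : Matrix (E.X j) (E.X j) ℂ)) i (E.ham i))

/-- The Hamiltonian `H ⊗ 1 + 1 ⊗ H_E` of the compound of system and environment. -/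
noncomputable def Environment.jointHam {n : Type*} [DecidableEq n] (E : Environment)
    (H : Matrix n n ℂ) : Matrix (n × E.Basis) (n × E.Basis) ℂ :=
  H ⊗ₖ (1 : Matrix E.Basis E.Basis ℂ) + (1 : Matrix n n ℂ) ⊗ₖ E.totalHam

/-- Applied to the initial system state `ρ` and the initial states `σ i` of the environment
systems, the evolution `U` brings the system `ε`-close to `ρf` in trace norm and changes the mean
energy of the compound by at most `ε'`. -/
def Achieves {n : Type*} [Fintype n] [DecidableEq n] (E : Environment) (H : Matrix n n ℂ)
    (U : Matrix (n × E.Basis) (n × E.Basis) ℂ) (ρ : Matrix n n ℂ)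
    (σ : ∀ i, Matrix (E.X i) (E.X i) ℂ) (ρf : Matrix n n ℂ) (ε ε' : ℝ) : Prop :=
  traceNorm (ρf - partialTrace (U * (ρ ⊗ₖ tensorProd σ) * Uᴴ)) ≤ ε ∧
    |meanEnergy (E.jointHam H) (U * (ρ ⊗ₖ tensorProd σ) * Uᴴ) -
      meanEnergy (E.jointHam H) (ρ ⊗ₖ tensorProd σ)| ≤ ε'

/-- `ρf` can be reached from the macrostate `(e, H)` by macrostate operations: a single unitary
works for all microstates of the system and of the environment systems. -/
def MacReachable {n : Type*} [Fintype n] [DecidableEq n] (β e : ℝ) (H ρf : Matrix n n ℂ) :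
    Prop :=
  ∀ ε > 0, ∀ ε' > 0, ∃ E : Environment, ∃ U ∈ Matrix.unitaryGroup (n × E.Basis) ℂ,
    ∀ ρ ∈ microstates e H, ∀ σ : ∀ i, Matrix (E.X i) (E.X i) ℂ,
      (∀ i, σ i ∈ microstates (thermalEnergy β (E.ham i)) (E.ham i)) →
        Achieves E H U ρ σ ρf ε ε'

/-- `ρf` can be reached from the microstate `ρ` by microstate operations, the system having the
Hamiltonian `H`. -/
def MicReachable {n : Type*} [Fintype n] [DecidableEq n] (β : ℝ) (H ρ ρf : Matrix n n ℂ) :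
    Prop :=
  ∀ ε > 0, ∀ ε' > 0, ∃ E : Environment, ∃ U ∈ Matrix.unitaryGroup (n × E.Basis) ℂ,
    Achieves E H U ρ (fun i => gibbs β (E.ham i)) ρf ε ε'

/-- Operational equivalence `(e, H) ∼_β ρ`: the same final states can be reached. -/
def OperationallyEquivalent {n : Type*} [Fintype n] [DecidableEq n] (β e : ℝ)
    (H ρ : Matrix n n ℂ) : Prop :=
  ∀ ρf : Matrix n n ℂ, IsDensityMatrix ρf → (MacReachable β e H ρf ↔ MicReachable β H ρ ρf)

/-! From macrostate to microstate operations there is nothing to build: the canonical ensemble and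
the thermal states of the environment are themselves microstates, so a unitary good for all
microstates is good for them.

Conversely, let `U` and an environment work for the canonical ensemble and thermal states. It
suffices to precede `U` by one unitary that turns every product of microstates approximately into
that thermal product, at almost no cost in mean energy. The resource is a bath of two-level systems:
with nonzero gap, the mean energy of a qubit fixes its populations, though not its coherences. The
whole compound of system and environment, in its energy eigenbasis, is swapped with one-hot
configurations of qubits whose gaps copy its levels. Each round replaces the populations by the
thermal ones with a fixed probability `r`, so the deviation decays like `(1 - r) ^ K`
(`exists_thermalizing_perm`). Almost degenerate qubits then act as controls of sign flips and
suppress the coherences (`exists_preparation`).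

The energy balance uses a modified Hamiltonian. If the canonical ensemble has inverse temperature
`b`, the system levels are rescaled by `b / β`, so that the target is a Gibbs distribution at the
single inverse temperature `β`. The swaps conserve this modified energy plus that of the qubits. Its
mean is the same for all microstates and for the target, because the system and the environment
parts are fixed separately; hence the qubits keep their mean energy exactly. The true energy of the
compound is likewise the same before the preparation and in the target, so continuity controls the
remaining error (`MicReachable.macReachable`).

At an extreme energy, where `b` is infinite, all microstates live on the extreme eigenspace. There
the ensemble is uniform, and the same argument runs on these levels with `b = 0`
(`IsCanonicalEnsemble.exists_populations`). -/

set_option linter.unusedSectionVars false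

/-! ### Trace norm against entrywise bounds -/

section TraceNorm

variable {n : Type*} [Fintype n] [DecidableEq n]

theorem sum_eigenvalues_eq_sum_norm_sq (A : Matrix n n ℂ) :
    ∑ i, (Matrix.isHermitian_conjTranspose_mul_self A).eigenvalues i =
      ∑ j, ∑ i, ‖A i j‖ ^ 2 := by
  have h := (Matrix.isHermitian_conjTranspose_mul_self A).trace_eq_sum_eigenvalues
  have h2 : (Aᴴ * A).trace = ((∑ j, ∑ i, ‖A i j‖ ^ 2 : ℝ) : ℂ) := by
    simp [Matrix.trace, Matrix.mul_apply, ← Complex.conj_mul']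
  rw [h2] at h
  refine Complex.ofReal_injective (Eq.trans ?_ h.symm)
  exact Complex.ofReal_sum _ _

theorem eigenvalues_conjTranspose_mul_self_nonneg (A : Matrix n n ℂ) (i : n) :
    0 ≤ (Matrix.isHermitian_conjTranspose_mul_self A).eigenvalues i :=
  (Matrix.posSemidef_conjTranspose_mul_self A).eigenvalues_nonneg i

/-- An entry is bounded by the Hilbert–Schmidt norm, and the 2-norm of the singular values by their
1-norm. -/
theorem norm_apply_le_traceNorm (A : Matrix n n ℂ) (i j : n) : ‖A i j‖ ≤ traceNorm A := by
  have h0 : 0 ≤ traceNorm A := Finset.sum_nonneg fun _ _ => Real.sqrt_nonneg _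
  refine le_of_sq_le_sq ?_ h0
  calc ‖A i j‖ ^ 2 ≤ ∑ i, ‖A i j‖ ^ 2 :=
        Finset.single_le_sum (f := fun i => ‖A i j‖ ^ 2) (fun _ _ => by positivity)
          (Finset.mem_univ i)
    _ ≤ ∑ j, ∑ i, ‖A i j‖ ^ 2 :=
        Finset.single_le_sum (f := fun j => ∑ i, ‖A i j‖ ^ 2)
          (fun _ _ => by positivity) (Finset.mem_univ j)
    _ = ∑ i, Real.sqrt ((Matrix.isHermitian_conjTranspose_mul_self A).eigenvalues i) ^ 2 := by
        rw [← sum_eigenvalues_eq_sum_norm_sq]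
        exact Finset.sum_congr rfl fun i _ =>
          (Real.sq_sqrt (eigenvalues_conjTranspose_mul_self_nonneg A i)).symm
    _ ≤ (traceNorm A) ^ 2 :=
        Finset.sum_sq_le_sq_sum_of_nonneg fun _ _ => Real.sqrt_nonneg _

theorem exists_forall_traceNorm_le {ε : ℝ} (hε : 0 < ε) :
    ∃ δ > 0, ∀ A : Matrix n n ℂ, (∀ i j, ‖A i j‖ ≤ δ) → traceNorm A ≤ ε := by
  set d : ℝ := (Fintype.card n : ℝ) with hd_def
  have hd : 0 ≤ d := Nat.cast_nonneg _
  -- There are `d` singular values, each at most the Hilbert–Schmidt norm, which is at most `d * δ`.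
  -- The `+ 1` covers dimension zero.
  refine ⟨ε / (d ^ 2 + 1), by positivity, fun A hA => ?_⟩
  set δ := ε / (d ^ 2 + 1)
  have hδ : 0 ≤ δ := by positivity
  have h1 : ∑ j, ∑ i, ‖A i j‖ ^ 2 ≤ (d * δ) ^ 2 := by
    calc ∑ j, ∑ i, ‖A i j‖ ^ 2 ≤ ∑ _j : n, ∑ _i : n, δ ^ 2 := by
          gcongr with j _ i _
          exact hA i j
      _ = (d * δ) ^ 2 := by simp [hd_def]; ring
  have h2 : ∀ i, Real.sqrt ((Matrix.isHermitian_conjTranspose_mul_self A).eigenvalues i) ≤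
      d * δ := fun i => by
    refine Real.sqrt_le_iff.2 ⟨by positivity, le_trans ?_ h1⟩
    rw [← sum_eigenvalues_eq_sum_norm_sq]
    exact Finset.single_le_sum
      (fun i _ => eigenvalues_conjTranspose_mul_self_nonneg A i) (Finset.mem_univ i)
  calc traceNorm A ≤ ∑ _i : n, d * δ := Finset.sum_le_sum fun i _ => h2 i
    _ = ε * (d ^ 2 / (d ^ 2 + 1)) := by simp [hd_def, δ]; ring
    _ ≤ ε * 1 := by
        gcongr
        rw [div_le_one (by positivity)]
        linarith
    _ = ε := mul_one ε

end TraceNorm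

/-! ### Spectral form of Hamiltonians and Gibbs states -/

section Spectral

variable {n : Type*} [Fintype n] [DecidableEq n]

/-- The matrix with eigenbasis `W` and eigenvalues `g`. -/
noncomputable def spectralMatrix (W : Matrix n n ℂ) (g : n → ℝ) : Matrix n n ℂ :=
  W * Matrix.diagonal (fun i => (g i : ℂ)) * Wᴴ

/-- The populations of `ρ` in the basis `W`. -/
def population (W ρ : Matrix n n ℂ) (l : n) : ℝ := ((Wᴴ * ρ * W) l l).re

/-- The Boltzmann distribution at inverse temperature `b`. -/
noncomputable def boltzmann (b : ℝ) (h : n → ℝ) (l : n) : ℝ :=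
  Real.exp (-(b * h l)) / ∑ i, Real.exp (-(b * h i))

theorem unitary_mul_conjTranspose {W : Matrix n n ℂ} (hW : W ∈ Matrix.unitaryGroup n ℂ) :
    W * Wᴴ = 1 := Matrix.mem_unitaryGroup_iff.1 hW

theorem unitary_conjTranspose_mul {W : Matrix n n ℂ} (hW : W ∈ Matrix.unitaryGroup n ℂ) :
    Wᴴ * W = 1 := Matrix.mem_unitaryGroup_iff'.1 hW

theorem Matrix.IsHermitian.exists_spectralMatrix {H : Matrix n n ℂ} (hH : H.IsHermitian) :
    ∃ W ∈ Matrix.unitaryGroup n ℂ, ∃ h : n → ℝ, H = spectralMatrix W h :=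
  ⟨hH.eigenvectorUnitary, hH.eigenvectorUnitary.2, hH.eigenvalues, hH.spectral_theorem⟩

theorem conjTranspose_mul_spectralMatrix_mul {W : Matrix n n ℂ}
    (hW : W ∈ Matrix.unitaryGroup n ℂ) (g : n → ℝ) :
    Wᴴ * spectralMatrix W g * W = Matrix.diagonal (fun i => (g i : ℂ)) := by
  simp only [spectralMatrix, Matrix.mul_assoc]
  rw [unitary_conjTranspose_mul hW, Matrix.mul_one, ← Matrix.mul_assoc,
    unitary_conjTranspose_mul hW, Matrix.one_mul]

theorem population_spectralMatrix {W : Matrix n n ℂ}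
    (hW : W ∈ Matrix.unitaryGroup n ℂ) (g : n → ℝ) : population W (spectralMatrix W g) = g := by
  ext l
  rw [population, conjTranspose_mul_spectralMatrix_mul hW]
  simp

theorem meanEnergy_spectralMatrix (W ρ : Matrix n n ℂ) (h : n → ℝ) :
    meanEnergy (spectralMatrix W h) ρ = ∑ l, population W ρ l * h l := by
  rw [meanEnergy, spectralMatrix, ← Matrix.mul_assoc, Matrix.trace_mul_comm, ← Matrix.mul_assoc,
    ← Matrix.mul_assoc]
  simp [Matrix.trace, population]

theorem IsDensityMatrix.conj {W ρ : Matrix n n ℂ} (hρ : IsDensityMatrix ρ)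
    (hW : W ∈ Matrix.unitaryGroup n ℂ) : IsDensityMatrix (Wᴴ * ρ * W) := by
  refine ⟨hρ.1.conjTranspose_mul_mul_same W, ?_⟩
  rw [Matrix.trace_mul_comm, ← Matrix.mul_assoc, unitary_mul_conjTranspose hW, Matrix.one_mul,
    hρ.2]

theorem IsDensityMatrix.ofReal_population {W ρ : Matrix n n ℂ} (hρ : IsDensityMatrix ρ) (l : n) :
    (population W ρ l : ℂ) = (Wᴴ * ρ * W) l l :=
  Complex.ext rfl <| by
    simpa using (Complex.nonneg_iff.1 (hρ.1.conjTranspose_mul_mul_same W).diag_nonneg).2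

theorem IsDensityMatrix.population_nonneg {W ρ : Matrix n n ℂ} (hρ : IsDensityMatrix ρ) (l : n) :
    0 ≤ population W ρ l :=
  (Complex.nonneg_iff.1 (hρ.1.conjTranspose_mul_mul_same W).diag_nonneg).1

theorem IsDensityMatrix.sum_population {W ρ : Matrix n n ℂ} (hρ : IsDensityMatrix ρ)
    (hW : W ∈ Matrix.unitaryGroup n ℂ) : ∑ l, population W ρ l = 1 := by
  simpa [Matrix.trace, population] using congrArg Complex.re (hρ.conj hW).2

theorem isDensityMatrix_spectralMatrix {W : Matrix n n ℂ} (hW : W ∈ Matrix.unitaryGroup n ℂ)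
    {g : n → ℝ} (hg : ∀ l, 0 ≤ g l) (hg1 : ∑ l, g l = 1) :
    IsDensityMatrix (spectralMatrix W g) := by
  refine ⟨Matrix.PosSemidef.mul_mul_conjTranspose_same (Matrix.PosSemidef.diagonal fun i => ?_) W,
    ?_⟩
  · exact Complex.zero_le_real.2 (hg i)
  · rw [spectralMatrix, Matrix.trace_mul_comm, ← Matrix.mul_assoc, unitary_conjTranspose_mul hW,
      Matrix.one_mul, Matrix.trace_diagonal]
    exact_mod_cast hg1

theorem gibbs_spectralMatrix {W : Matrix n n ℂ} (hW : W ∈ Matrix.unitaryGroup n ℂ) (b : ℝ)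
    (h : n → ℝ) : gibbs b (spectralMatrix W h) = spectralMatrix W (boltzmann b h) := by
  have hinv : W⁻¹ = Wᴴ := Matrix.inv_eq_right_inv (unitary_mul_conjTranspose hW)
  have hunit : IsUnit W :=
    ⟨⟨W, Wᴴ, unitary_mul_conjTranspose hW, unitary_conjTranspose_mul hW⟩, rfl⟩
  have hexp : NormedSpace.exp (-(b : ℂ) • spectralMatrix W h) =
      spectralMatrix W fun l => Real.exp (-(b * h l)) := by
    have h1 : -(b : ℂ) • spectralMatrix W h =
        W * Matrix.diagonal (fun i => ((-(b * h i) : ℝ) : ℂ)) * W⁻¹ := by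
      rw [hinv, spectralMatrix, ← Matrix.smul_mul, ← Matrix.mul_smul, ← Matrix.diagonal_smul]
      congr 3
      ext i
      simp
    rw [h1, Matrix.exp_conj _ _ hunit, Matrix.exp_diagonal, hinv, spectralMatrix]
    congr 3
    ext i
    rw [Pi.coe_exp, ← Complex.exp_eq_exp_ℂ, Complex.ofReal_exp]
  have htr : (spectralMatrix W fun l => Real.exp (-(b * h l))).trace =
      ((∑ l, Real.exp (-(b * h l)) : ℝ) : ℂ) := by
    rw [spectralMatrix, Matrix.trace_mul_comm, ← Matrix.mul_assoc, unitary_conjTranspose_mul hW,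
      Matrix.one_mul, Matrix.trace_diagonal, Complex.ofReal_sum]
  rw [gibbs, hexp, htr, spectralMatrix, spectralMatrix, ← Matrix.smul_mul, ← Matrix.mul_smul,
    ← Matrix.diagonal_smul]
  congr 3
  ext i
  simp [boltzmann, div_eq_inv_mul]

theorem sum_boltzmann [Nonempty n] (b : ℝ) (h : n → ℝ) : ∑ l, boltzmann b h l = 1 := by
  have : 0 < ∑ i, Real.exp (-(b * h i)) := by positivity
  simp only [boltzmann, ← Finset.sum_div]
  exact div_self this.ne'

theorem boltzmann_nonneg (b : ℝ) (h : n → ℝ) (l : n) : 0 ≤ boltzmann b h l := by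
  unfold boltzmann
  positivity

theorem isDensityMatrix_gibbs [Nonempty n] {H : Matrix n n ℂ} (hH : H.IsHermitian) (b : ℝ) :
    IsDensityMatrix (gibbs b H) := by
  obtain ⟨W, hW, h, rfl⟩ := hH.exists_spectralMatrix
  rw [gibbs_spectralMatrix hW]
  exact isDensityMatrix_spectralMatrix hW (boltzmann_nonneg b h) (sum_boltzmann b h)

/-- This symmetry reduces the greatest eigenvalue and `b → -∞` to the least eigenvalue and `b → +∞`.
-/
theorem gibbs_neg_neg (b : ℝ) (H : Matrix n n ℂ) : gibbs (-b) (-H) = gibbs b H := by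
  simp [gibbs]

theorem isClosed_isDensityMatrix : IsClosed {ρ : Matrix n n ℂ | IsDensityMatrix ρ} := by
  have h : {ρ : Matrix n n ℂ | IsDensityMatrix ρ} =
      {ρ | ρᴴ = ρ} ∩ (⋂ x : n → ℂ, {ρ | 0 ≤ star x ⬝ᵥ ρ.mulVec x}) ∩ {ρ | ρ.trace = 1} := by
    ext ρ
    simp [IsDensityMatrix, Matrix.posSemidef_iff_dotProduct_mulVec, Matrix.IsHermitian]
  rw [h]
  refine ((isClosed_eq (by fun_prop) (by fun_prop)).inter
    (isClosed_iInter fun x => ?_)).inter (isClosed_eq (by fun_prop) (by fun_prop))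
  exact isClosed_le continuous_const (by fun_prop)

end Spectral

/-! ### Existence and shape of the canonical ensemble -/

section Canonical

variable {n : Type*} [Fintype n] [DecidableEq n]

theorem continuous_boltzmann (h : n → ℝ) [Nonempty n] (l : n) :
    Continuous fun b => boltzmann b h l := by
  have h0 : ∀ b : ℝ, ∑ i, Real.exp (-(b * h i)) ≠ 0 := fun b => by positivity
  unfold boltzmann
  exact Continuous.div (by fun_prop) (by fun_prop) h0

/-- With energies measured from the ground level, every exponential has a finite limit as `b → +∞`.
-/
theorem boltzmann_eq_shift (b : ℝ) (h : n → ℝ) (c : ℝ) (l : n) :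
    boltzmann b h l = Real.exp (-(b * (h l - c))) / ∑ i, Real.exp (-(b * (h i - c))) := by
  have : ∀ i, Real.exp (-(b * (h i - c))) = Real.exp (-(b * h i)) * Real.exp (b * c) := fun i => by
    rw [← Real.exp_add]
    ring_nf
  simp only [this, ← Finset.sum_mul, boltzmann]
  rw [mul_div_mul_right _ _ (Real.exp_ne_zero _)]

/-- The uniform distribution on the levels where `h` is equal to `c`. -/
noncomputable def uniformOn (h : n → ℝ) (c : ℝ) (l : n) : ℝ :=
  (if h l = c then 1 else 0) / ∑ i, if h i = c then 1 else 0

theorem card_level_pos (h : n → ℝ) (l₀ : n) :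
    0 < ∑ i, if h i = h l₀ then (1 : ℝ) else 0 := by
  refine lt_of_lt_of_le zero_lt_one ?_
  calc (1 : ℝ) = if h l₀ = h l₀ then 1 else 0 := by simp
    _ ≤ _ := Finset.single_le_sum (f := fun i => if h i = h l₀ then (1 : ℝ) else 0)
      (fun i _ => by positivity) (Finset.mem_univ l₀)

theorem tendsto_boltzmann_atTop {h : n → ℝ} {l₀ : n} (hl : ∀ l, h l₀ ≤ h l) (l : n) :
    Tendsto (fun b => boltzmann b h l) atTop (𝓝 (uniformOn h (h l₀) l)) := by
  have key : ∀ i, Tendsto (fun b : ℝ => Real.exp (-(b * (h i - h l₀)))) atTop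
      (𝓝 (if h i = h l₀ then 1 else 0)) := fun i => by
    split_ifs with hi
    · simp [hi]
    · have hpos : 0 < h i - h l₀ := sub_pos.2 (lt_of_le_of_ne (hl i) (Ne.symm hi))
      exact Real.tendsto_exp_neg_atTop_nhds_zero.comp (tendsto_id.atTop_mul_const hpos)
  have h1 := (card_level_pos h l₀).ne'
  simp only [boltzmann_eq_shift _ h (h l₀)]
  exact (key l).div (tendsto_finsetSum _ fun i _ => key i) h1

theorem continuous_spectralMatrix (W : Matrix n n ℂ) : Continuous (spectralMatrix W) := by
  unfold spectralMatrix
  fun_prop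

theorem tendsto_gibbs_atTop {W : Matrix n n ℂ} (hW : W ∈ Matrix.unitaryGroup n ℂ) {h : n → ℝ}
    {l₀ : n} (hl : ∀ l, h l₀ ≤ h l) :
    Tendsto (fun b => gibbs b (spectralMatrix W h)) atTop
      (𝓝 (spectralMatrix W (uniformOn h (h l₀)))) := by
  simp only [gibbs_spectralMatrix hW]
  exact ((continuous_spectralMatrix W).tendsto _).comp
    (tendsto_pi_nhds.2 (tendsto_boltzmann_atTop hl))

theorem spectralMatrix_neg (W : Matrix n n ℂ) (h : n → ℝ) :
    spectralMatrix W (-h) = -spectralMatrix W h := by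
  have : (fun i => (((-h) i : ℝ) : ℂ)) = fun i => -(h i : ℂ) := by
    ext i
    simp
  rw [spectralMatrix, spectralMatrix, this, ← Matrix.diagonal_neg, Matrix.mul_neg, Matrix.neg_mul]

theorem meanEnergy_neg (H ρ : Matrix n n ℂ) : meanEnergy (-H) ρ = -meanEnergy H ρ := by
  simp [meanEnergy]

theorem IsCanonicalEnsemble.of_neg {e : ℝ} {H γ : Matrix n n ℂ}
    (h : IsCanonicalEnsemble (-e) (-H) γ) : IsCanonicalEnsemble e H γ := by
  have hg : ∀ b : ℝ, gibbs b (-H) = gibbs (-b) H := fun b => by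
    rw [← gibbs_neg_neg, neg_neg]
  obtain ⟨h1, h2⟩ := h
  refine ⟨neg_injective (by rw [← meanEnergy_neg, h1]), ?_⟩
  rcases h2 with ⟨b, rfl⟩ | h2 | h2
  · exact Or.inl ⟨-b, hg b⟩
  · refine Or.inr (Or.inr ?_)
    simpa [Function.comp_def, hg] using h2.comp tendsto_neg_atBot_atTop
  · refine Or.inr (Or.inl ?_)
    simpa [Function.comp_def, hg] using h2.comp tendsto_neg_atTop_atBot

theorem sum_uniformOn_mul {h : n → ℝ} (l₀ : n) :
    ∑ l, uniformOn h (h l₀) l * h l = h l₀ := by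
  have h1 := (card_level_pos h l₀).ne'
  calc ∑ l, uniformOn h (h l₀) l * h l = ∑ l, uniformOn h (h l₀) l * h l₀ :=
        Finset.sum_congr rfl fun l _ => by
          unfold uniformOn
          split_ifs with hl
          · rw [hl]
          · simp
    _ = h l₀ := by
        simp only [uniformOn]
        rw [← Finset.sum_mul, ← Finset.sum_div, div_self h1, one_mul]

theorem meanEnergy_uniformOn {W : Matrix n n ℂ} (hW : W ∈ Matrix.unitaryGroup n ℂ) {h : n → ℝ}
    (l₀ : n) :
    meanEnergy (spectralMatrix W h) (spectralMatrix W (uniformOn h (h l₀))) = h l₀ := by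
  rw [meanEnergy_spectralMatrix, population_spectralMatrix hW, sum_uniformOn_mul]

theorem isCanonicalEnsemble_uniformOn {W : Matrix n n ℂ} (hW : W ∈ Matrix.unitaryGroup n ℂ)
    {h : n → ℝ} {l₀ : n} (hl : ∀ l, h l₀ ≤ h l) :
    IsCanonicalEnsemble (h l₀) (spectralMatrix W h) (spectralMatrix W (uniformOn h (h l₀))) :=
  ⟨meanEnergy_uniformOn hW l₀, Or.inr (Or.inl (tendsto_gibbs_atTop hW hl))⟩

theorem tendsto_sum_boltzmann_mul_atTop {h : n → ℝ} {l₀ : n} (hl : ∀ l, h l₀ ≤ h l) :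
    Tendsto (fun b => ∑ l, boltzmann b h l * h l) atTop (𝓝 (h l₀)) := by
  have := tendsto_finsetSum Finset.univ fun l (_ : l ∈ Finset.univ) =>
    (tendsto_boltzmann_atTop hl l).mul_const (h l)
  rwa [sum_uniformOn_mul] at this

theorem boltzmann_neg_neg (b : ℝ) (h : n → ℝ) : boltzmann (-b) (-h) = boltzmann b h := by
  ext l
  simp [boltzmann]

/-- The energy `e` is an average of eigenvalues. At the ends of the spectrum the limits of Gibbs
states serve; strictly inside, the Gibbs energy is continuous in `b` and tends to the two ends, so
the intermediate value theorem applies. -/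
theorem exists_isCanonicalEnsemble {H : Matrix n n ℂ} (hH : H.IsHermitian) {e : ℝ}
    (he : (microstates e H).Nonempty) : ∃ γ, IsCanonicalEnsemble e H γ := by
  obtain ⟨W, hW, h, rfl⟩ := hH.exists_spectralMatrix
  obtain ⟨ρ, hρ, rfl⟩ := he
  have hsum := hρ.sum_population hW
  have : Nonempty n := by
    by_contra hn
    rw [not_nonempty_iff] at hn
    simp at hsum
  obtain ⟨l₀, hl₀⟩ := Finite.exists_min h
  obtain ⟨l₁, hl₁⟩ := Finite.exists_max h
  set e := meanEnergy (spectralMatrix W h) ρ with he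
  rw [meanEnergy_spectralMatrix] at he
  have h0 : h l₀ ≤ e := by
    calc h l₀ = ∑ l, population W ρ l * h l₀ := by rw [← Finset.sum_mul, hsum, one_mul]
      _ ≤ e := he ▸ Finset.sum_le_sum fun l _ =>
        mul_le_mul_of_nonneg_left (hl₀ l) (hρ.population_nonneg l)
  have h1 : e ≤ h l₁ := by
    calc e ≤ ∑ l, population W ρ l * h l₁ := he ▸ Finset.sum_le_sum fun l _ =>
        mul_le_mul_of_nonneg_left (hl₁ l) (hρ.population_nonneg l)
      _ = h l₁ := by rw [← Finset.sum_mul, hsum, one_mul]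
  rcases h0.eq_or_lt with h0 | h0
  · exact ⟨_, h0 ▸ isCanonicalEnsemble_uniformOn hW hl₀⟩
  rcases h1.eq_or_lt with h1 | h1
  · have := isCanonicalEnsemble_uniformOn hW (h := -h) (l₀ := l₁) fun l => by simpa using hl₁ l
    rw [spectralMatrix_neg, Pi.neg_apply, ← h1] at this
    exact ⟨_, this.of_neg⟩
  have hbot : Tendsto (fun b => ∑ l, boltzmann b h l * h l) atBot (𝓝 (h l₁)) := by
    have := (tendsto_sum_boltzmann_mul_atTop (h := -h) (l₀ := l₁)
      fun l => by simpa using hl₁ l).neg.comp tendsto_neg_atBot_atTop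
    simpa [Function.comp_def, boltzmann_neg_neg] using this
  obtain ⟨b, hb⟩ := mem_range_of_exists_le_of_exists_ge
    (continuous_finsetSum Finset.univ fun l _ =>
      (continuous_boltzmann h l).mul_const (h l) :
      Continuous fun b => ∑ l, boltzmann b h l * h l)
    (((tendsto_sum_boltzmann_mul_atTop hl₀).eventually_le_const h0).exists)
    ((hbot.eventually_const_le h1).exists)
  refine ⟨gibbs b (spectralMatrix W h), ?_, Or.inl ⟨b, rfl⟩⟩
  rw [gibbs_spectralMatrix hW, meanEnergy_spectralMatrix, population_spectralMatrix hW]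
  exact hb

theorem IsCanonicalEnsemble.isDensityMatrix [Nonempty n] {H : Matrix n n ℂ} (hH : H.IsHermitian)
    {e : ℝ} {γ : Matrix n n ℂ} (hγ : IsCanonicalEnsemble e H γ) : IsDensityMatrix γ := by
  rcases hγ.2 with ⟨b, rfl⟩ | h | h
  · exact isDensityMatrix_gibbs hH b
  all_goals
    exact isClosed_isDensityMatrix.mem_of_tendsto h
      (Eventually.of_forall fun b => isDensityMatrix_gibbs hH b)

/-- The mean of the nonnegative quantity `h l - h l₀` vanishes, so no level with positive excess is
occupied. -/
theorem population_eq_zero_of_meanEnergy_eq {W ρ : Matrix n n ℂ}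
    (hW : W ∈ Matrix.unitaryGroup n ℂ) (hρ : IsDensityMatrix ρ) {h : n → ℝ} {l₀ : n}
    (hl : ∀ l, h l₀ ≤ h l) (he : meanEnergy (spectralMatrix W h) ρ = h l₀) {l : n}
    (hne : h l ≠ h l₀) : population W ρ l = 0 := by
  have h0 : ∑ l, population W ρ l * (h l - h l₀) = 0 := by
    simp only [mul_sub, Finset.sum_sub_distrib]
    rw [← Finset.sum_mul, hρ.sum_population hW, ← meanEnergy_spectralMatrix, he]
    ring
  have := (Finset.sum_eq_zero_iff_of_nonneg fun l _ =>
    mul_nonneg (hρ.population_nonneg l) (sub_nonneg.2 (hl l))).1 h0 l (Finset.mem_univ l)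
  exact (mul_eq_zero.1 this).resolve_right (sub_ne_zero.2 hne)

/-- The canonical ensemble is a Gibbs distribution, at a finite inverse temperature, on a set of
levels that carries all microstates. -/
theorem IsCanonicalEnsemble.exists_populations {W : Matrix n n ℂ}
    (hW : W ∈ Matrix.unitaryGroup n ℂ) {h : n → ℝ} [Nonempty n] {e : ℝ} {γ : Matrix n n ℂ}
    (hγ : IsCanonicalEnsemble e (spectralMatrix W h) γ) :
    ∃ (b : ℝ) (L : Set n) (g : n → ℝ), γ = spectralMatrix W g ∧
      (∃ C, ∀ l ∈ L, Real.exp (-(b * h l)) = C * g l) ∧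
      ∀ ρ ∈ microstates e (spectralMatrix W h), ∀ l ∉ L, population W ρ l = 0 := by
  obtain ⟨l₀, hl₀⟩ := Finite.exists_min h
  obtain ⟨l₁, hl₁⟩ := Finite.exists_max h
  -- For an infinite inverse temperature the ensemble is constant on the extreme levels, hence there
  -- proportional to the weights at `b = 0`.
  have hunif : ∀ (h' : n → ℝ) (l' : n), ∃ C, ∀ l ∈ {l | h' l = h' l'},
      Real.exp (-(0 * h l)) = C * uniformOn h' (h' l') l := fun h' l' => by
    have h1 := card_level_pos h' l'
    refine ⟨∑ i, if h' i = h' l' then 1 else 0, fun l hl => ?_⟩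
    rw [Set.mem_ofPred_eq] at hl
    rw [uniformOn, if_pos hl, mul_div_cancel₀ _ h1.ne']
    simp
  rcases hγ.2 with ⟨b, rfl⟩ | h2 | h2
  · refine ⟨b, Set.univ, boltzmann b h, gibbs_spectralMatrix hW b h,
      ⟨∑ i, Real.exp (-(b * h i)), fun l _ => ?_⟩, fun ρ _ l hl => (hl trivial).elim⟩
    rw [boltzmann, mul_div_cancel₀]
    positivity
  · have hlim := tendsto_nhds_unique h2 (tendsto_gibbs_atTop hW hl₀)
    subst hlim
    have he := hγ.1
    rw [meanEnergy_uniformOn hW] at he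
    exact ⟨0, {l | h l = h l₀}, _, rfl, hunif h l₀, fun ρ hρ l hl =>
      population_eq_zero_of_meanEnergy_eq hW hρ.1 hl₀ (hρ.2.trans he.symm) hl⟩
  · have hl₁' : ∀ l, (-h) l₁ ≤ (-h) l := fun l => by simpa using hl₁ l
    have h3 := tendsto_gibbs_atTop hW hl₁'
    have h2' : Tendsto (fun b => gibbs b (spectralMatrix W (-h))) atTop (𝓝 γ) := by
      have := h2.comp tendsto_neg_atTop_atBot
      have hg : ∀ b : ℝ, gibbs b (spectralMatrix W (-h)) = gibbs (-b) (spectralMatrix W h) :=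
          fun b => by
        rw [← gibbs_neg_neg, spectralMatrix_neg, neg_neg]
      simpa [Function.comp_def, hg] using this
    have hlim := tendsto_nhds_unique h2' h3
    subst hlim
    have he := hγ.1
    rw [← neg_neg (spectralMatrix W h), ← spectralMatrix_neg, meanEnergy_neg,
      meanEnergy_uniformOn hW] at he
    refine ⟨0, {l | (-h) l = (-h) l₁}, _, rfl, hunif (-h) l₁, fun ρ hρ l hl =>
      population_eq_zero_of_meanEnergy_eq hW hρ.1 hl₁' ?_ hl⟩
    rw [spectralMatrix_neg, meanEnergy_neg, hρ.2, ← he, neg_neg]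

end Canonical

/-! ### Thermal populations of a register of qubits -/

section Qubits

variable {N : Type*} [Fintype N]

/-- The energy of the configuration `z` of qubits with excitation energies `w`. -/
def qubitEnergy (w : N → ℝ) (z : N → Bool) : ℝ := ∑ i, if z i then w i else 0

/-- The thermal population of the level `b` of a qubit with excitation energy `w`. -/
noncomputable def qubitPop (β w : ℝ) (b : Bool) : ℝ :=
  Real.exp (-(β * if b then w else 0)) / (1 + Real.exp (-(β * w)))

/-- The thermal population of the configuration `z` of qubits with excitation energies `w`. -/
noncomputable def qubitProb (β : ℝ) (w : N → ℝ) (z : N → Bool) : ℝ :=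
  ∏ i, qubitPop β (w i) (z i)

theorem qubitPop_pos (β w : ℝ) (b : Bool) : 0 < qubitPop β w b := by
  unfold qubitPop
  positivity

theorem qubitPop_true_add_false (β w : ℝ) : qubitPop β w true + qubitPop β w false = 1 := by
  have : 1 + Real.exp (-(β * w)) ≠ 0 := by positivity
  simp only [qubitPop, if_true, Bool.false_eq_true, if_false, mul_zero, neg_zero, Real.exp_zero]
  field_simp
  ring

theorem sum_prod_bool [DecidableEq N] {R : Type*} [CommSemiring R] (g : N → Bool → R) :
    ∑ z : N → Bool, ∏ i, g i (z i) = ∏ i, (g i true + g i false) := by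
  have h := Finset.prod_univ_sum (fun _ : N => (Finset.univ : Finset Bool)) g
  rw [Fintype.piFinset_univ] at h
  rw [← h]
  simp

theorem sum_qubitProb [DecidableEq N] (β : ℝ) (w : N → ℝ) : ∑ z, qubitProb β w z = 1 := by
  simp [qubitProb, sum_prod_bool, qubitPop_true_add_false]

theorem qubitProb_pos (β : ℝ) (w : N → ℝ) (z : N → Bool) : 0 < qubitProb β w z :=
  Finset.prod_pos fun _ _ => qubitPop_pos _ _ _

theorem qubitProb_eq (β : ℝ) (w : N → ℝ) (z : N → Bool) :
    qubitProb β w z =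
      Real.exp (-(β * qubitEnergy w z)) / ∏ i, (1 + Real.exp (-(β * w i))) := by
  simp only [qubitProb, qubitPop, Finset.prod_div_distrib, qubitEnergy, ← Real.exp_sum,
    Finset.mul_sum, Finset.sum_neg_distrib]

theorem qubitEnergy_sumElim {N' : Type*} [Fintype N'] (w : N → ℝ) (w' : N' → ℝ)
    (z : N ⊕ N' → Bool) :
    qubitEnergy (Sum.elim w w') z =
      qubitEnergy w (z ∘ Sum.inl) + qubitEnergy w' (z ∘ Sum.inr) := by
  simp [qubitEnergy]

theorem qubitProb_sumElim {N' : Type*} [Fintype N'] (β : ℝ) (w : N → ℝ) (w' : N' → ℝ)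
    (z : N ⊕ N' → Bool) :
    qubitProb β (Sum.elim w w') z =
      qubitProb β w (z ∘ Sum.inl) * qubitProb β w' (z ∘ Sum.inr) := by
  simp [qubitProb]

end Qubits

/-! ### Thermalization of populations by energy-conserving swaps -/

section Thermalize

variable {m : Type*} [Fintype m] [DecidableEq m] {Q : Type} [Fintype Q] [DecidableEq Q]

/-- The configuration in which exactly the qubit `q` is excited. -/
def oneHot (q : Q) : Q → Bool := fun j => decide (j = q)

theorem oneHot_injective : Function.Injective (oneHot : Q → Q → Bool) := fun a b h => by
  simpa [oneHot] using congrFun h a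

theorem qubitEnergy_oneHot (w : Q → ℝ) (q : Q) : qubitEnergy w (oneHot q) = w q := by
  simp [qubitEnergy, oneHot]

/-- A level of the system together with a one-hot configuration of the qubits. -/
def oneHotEmbedding (f : Q ↪ m) : Q × Q ↪ m × (Q → Bool) where
  toFun x := (f x.1, oneHot x.2)
  inj' x y h := by
    rw [Prod.mk.injEq] at h
    exact Prod.ext (f.injective h.1) (oneHot_injective h.2)

/-- The swap of the system with the one-hot configurations of the qubits. -/
noncomputable def oneHotSwap (f : Q ↪ m) : Equiv.Perm (m × (Q → Bool)) :=
  Equiv.Perm.viaFintypeEmbedding (Equiv.prodComm Q Q) (oneHotEmbedding f)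

theorem oneHotSwap_apply (f : Q ↪ m) (q q' : Q) :
    oneHotSwap f (f q, oneHot q') = (f q', oneHot q) :=
  Equiv.Perm.viaFintypeEmbedding_apply_image _ (oneHotEmbedding f) (q, q')

theorem oneHotSwap_of_notMem (f : Q ↪ m) {x : m × (Q → Bool)}
    (hx : x ∉ Set.range (oneHotEmbedding f)) : oneHotSwap f x = x :=
  Equiv.Perm.viaFintypeEmbedding_apply_notMem_range _ _ hx

theorem oneHotSwap_symm_apply (f : Q ↪ m) (q q' : Q) :
    (oneHotSwap f).symm (f q, oneHot q') = (f q', oneHot q) := by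
  rw [Equiv.symm_apply_eq, oneHotSwap_apply]

theorem oneHotSwap_symm_of_notMem (f : Q ↪ m) {x : m × (Q → Bool)}
    (hx : x ∉ Set.range (oneHotEmbedding f)) : (oneHotSwap f).symm x = x := by
  rw [Equiv.symm_apply_eq, oneHotSwap_of_notMem f hx]

/-- Both swapped states have energy `k (f q) + k (f q') + c`. The offset `c` is harmless because
exactly one qubit is excited on either side. -/
theorem oneHotSwap_conserves (f : Q ↪ m) (k : m → ℝ) (c : ℝ) (x : m × (Q → Bool)) :
    k (oneHotSwap f x).1 + qubitEnergy (fun q => k (f q) + c) (oneHotSwap f x).2 =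
      k x.1 + qubitEnergy (fun q => k (f q) + c) x.2 := by
  by_cases hx : x ∈ Set.range (oneHotEmbedding f)
  · obtain ⟨⟨q, q'⟩, rfl⟩ := hx
    change k (oneHotSwap f (f q, oneHot q')).1 + qubitEnergy _ (oneHotSwap f (f q, oneHot q')).2 =
      k (f q) + qubitEnergy _ (oneHot q')
    rw [oneHotSwap_apply, qubitEnergy_oneHot, qubitEnergy_oneHot]
    ring
  · rw [oneHotSwap_of_notMem f hx]

/-- The register is one-hot with probability `r`, and given this the excited qubit has distribution
`τ`. Then the swap replaces the system by a sample of `τ`; otherwise nothing happens. -/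
theorem sum_oneHotSwap (f : Q ↪ m) {P : (Q → Bool) → ℝ} (hP : ∑ b, P b = 1) {r : ℝ} {τ : m → ℝ}
    (hτ : ∀ q, P (oneHot q) = r * τ (f q)) (hτ0 : ∀ l ∉ Set.range f, τ l = 0)
    (hr : ∑ q, P (oneHot q) = r) {ρ : m → ℝ} (hρ0 : ∀ l ∉ Set.range f, ρ l = 0)
    (hρ1 : ∑ l, ρ l = 1) (l : m) :
    ∑ b, ρ ((oneHotSwap f).symm (l, b)).1 * P ((oneHotSwap f).symm (l, b)).2 =
      (1 - r) * ρ l + r * τ l := by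
  by_cases hl : l ∈ Set.range f
  · obtain ⟨q', rfl⟩ := hl
    have h1 : ∑ q, (ρ (f q) * P (oneHot q') - ρ (f q') * P (oneHot q)) =
        ∑ b, (ρ ((oneHotSwap f).symm (f q', b)).1 * P ((oneHotSwap f).symm (f q', b)).2 -
          ρ (f q') * P b) := by
      refine Fintype.sum_of_injective oneHot oneHot_injective _ _ (fun b hb => ?_) fun q => ?_
      · rw [oneHotSwap_symm_of_notMem, sub_self]
        rintro ⟨⟨q, q''⟩, h⟩
        exact hb ⟨q'', congrArg Prod.snd h⟩
      · rw [oneHotSwap_symm_apply]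
    have h2 : ∑ q, ρ (f q) = 1 := by
      rw [← hρ1]
      exact Fintype.sum_of_injective f f.injective _ _ hρ0 fun _ => rfl
    rw [Finset.sum_sub_distrib, Finset.sum_sub_distrib, ← Finset.sum_mul, ← Finset.mul_sum,
      ← Finset.mul_sum, h2, hP, hr, hτ] at h1
    linarith
  · have h1 : ∀ b, (oneHotSwap f).symm (l, b) = (l, b) := fun b => by
      refine oneHotSwap_symm_of_notMem f ?_
      rintro ⟨⟨q, q'⟩, h⟩
      exact hl ⟨q, congrArg Prod.fst h⟩
    simp [h1, hρ0 l hl, hτ0 l hl]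

/-- First `σ` on the system and one part of the qubits, then `π` on the system and the others. -/
def permSeq {N : Type} (σ : Equiv.Perm (m × (Q → Bool))) (π : Equiv.Perm (m × (N → Bool))) :
    Equiv.Perm (m × (Q ⊕ N → Bool)) where
  toFun x :=
    let y := σ (x.1, x.2 ∘ Sum.inl)
    let y' := π (y.1, x.2 ∘ Sum.inr)
    (y'.1, Sum.elim y.2 y'.2)
  invFun x :=
    let y' := π.symm (x.1, x.2 ∘ Sum.inr)
    let y := σ.symm (y'.1, x.2 ∘ Sum.inl)
    (y.1, Sum.elim y.2 y'.2)
  left_inv x := by simp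
  right_inv x := by simp

/-- By swaps with thermal qubits, a permutation brings any distribution on the levels `range f` as
close as desired to the thermal one, and conserves the energy. -/
theorem exists_thermalizing_perm [Nonempty Q] (β : ℝ) (f : Q ↪ m) (k τ : m → ℝ)
    (hτ : ∃ C, ∀ q, Real.exp (-(β * k (f q))) = C * τ (f q))
    (hτ0 : ∀ l ∉ Set.range f, τ l = 0) (hτ1 : ∑ l, τ l = 1) {η : ℝ} (hη : 0 < η) :
    ∃ (N : Type) (_ : Fintype N) (_ : DecidableEq N) (w : N → ℝ), (∀ i, w i ≠ 0) ∧
      ∃ π : Equiv.Perm (m × (N → Bool)),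
        (∀ x, k (π x).1 + qubitEnergy w (π x).2 = k x.1 + qubitEnergy w x.2) ∧
        ∃ a, 0 ≤ a ∧ a ≤ η ∧ ∀ ρ : m → ℝ, (∀ l ∉ Set.range f, ρ l = 0) → ∑ l, ρ l = 1 → ∀ l,
          ∑ z, ρ (π.symm (l, z)).1 * qubitProb β w (π.symm (l, z)).2 =
            a * ρ l + (1 - a) * τ l := by
  obtain ⟨C, hCτ⟩ := hτ
  -- An offset that makes all gaps positive; a qubit of gap zero would have populations not fixed by
  -- its mean energy.
  set c : ℝ := 1 + ∑ q, |k (f q)| with hc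
  have hw : ∀ q, k (f q) + c ≠ 0 := fun q => by
    have h1 := Finset.single_le_sum (f := fun q => |k (f q)|) (fun _ _ => abs_nonneg _)
      (Finset.mem_univ q)
    have h2 := neg_abs_le (k (f q))
    refine ne_of_gt ?_
    linarith
  set w₀ : Q → ℝ := fun q => k (f q) + c with hw₀
  set r : ℝ := ∑ q, qubitProb β w₀ (oneHot q) with hr
  have hr0 : 0 < r := Finset.sum_pos (fun q _ => qubitProb_pos _ _ _) Finset.univ_nonempty
  have hr1 : r ≤ 1 := by
    rw [hr, ← sum_qubitProb β w₀, ← Finset.sum_image (f := qubitProb β w₀)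
      (fun a _ b _ h => oneHot_injective h)]
    exact Finset.sum_le_sum_of_subset_of_nonneg (Finset.subset_univ _)
      fun _ _ _ => (qubitProb_pos _ _ _).le
  have hprop : ∃ D, ∀ q, qubitProb β w₀ (oneHot q) = D * τ (f q) := by
    refine ⟨Real.exp (-(β * c)) * C / ∏ i, (1 + Real.exp (-(β * w₀ i))), fun q => ?_⟩
    have : Real.exp (-(β * w₀ q)) = Real.exp (-(β * c)) * (C * τ (f q)) := by
      rw [← hCτ, ← Real.exp_add]
      simp only [hw₀]
      ring_nf
    rw [qubitProb_eq, qubitEnergy_oneHot, this]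
    ring
  obtain ⟨D, hD⟩ := hprop
  -- Since `τ` is normalized on `range f`, the proportionality constant is the total one-hot
  -- probability.
  have hDr : D = r := by
    have h2 : ∑ q, τ (f q) = 1 := by
      rw [← hτ1]
      exact Fintype.sum_of_injective f f.injective _ _ hτ0 fun _ => rfl
    rw [hr, Finset.sum_congr rfl fun q _ => hD q, ← Finset.mul_sum, h2, mul_one]
  subst hDr
  have key : ∀ K : ℕ, ∃ (N : Type) (_ : Fintype N) (_ : DecidableEq N) (w : N → ℝ),
      (∀ i, w i ≠ 0) ∧ ∃ π : Equiv.Perm (m × (N → Bool)),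
        (∀ x, k (π x).1 + qubitEnergy w (π x).2 = k x.1 + qubitEnergy w x.2) ∧
        ∀ ρ : m → ℝ, (∀ l ∉ Set.range f, ρ l = 0) → ∑ l, ρ l = 1 → ∀ l,
          ∑ z, ρ (π.symm (l, z)).1 * qubitProb β w (π.symm (l, z)).2 =
            (1 - r) ^ K * ρ l + (1 - (1 - r) ^ K) * τ l := by
    intro K
    induction K with
    | zero =>
      refine ⟨Empty, inferInstance, inferInstance, fun _ => 0, fun i => i.elim, Equiv.refl _,
        fun x => rfl, fun ρ _ _ l => ?_⟩
      simp [qubitProb]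
    | succ K ih =>
      obtain ⟨N, _, _, w, hwN, π, hπ, hpop⟩ := ih
      refine ⟨Q ⊕ N, inferInstance, inferInstance, Sum.elim w₀ w, ?_,
        permSeq (oneHotSwap f) π, fun x => ?_, fun ρ hρ0 hρ1 l => ?_⟩
      · rintro (q | i)
        exacts [hw q, hwN i]
      · have h1 := oneHotSwap_conserves f k c (x.1, x.2 ∘ Sum.inl)
        have h2 := hπ ((oneHotSwap f (x.1, x.2 ∘ Sum.inl)).1, x.2 ∘ Sum.inr)
        rw [qubitEnergy_sumElim, qubitEnergy_sumElim]
        simp only [permSeq, Equiv.coe_fn_mk, Sum.elim_comp_inl, Sum.elim_comp_inr]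
        simp only at h1 h2
        linarith
      · have hstep := sum_oneHotSwap f (sum_qubitProb β w₀) hD hτ0 hr.symm hρ0 hρ1
        have hρ0' : ∀ l ∉ Set.range f, (1 - r) * ρ l + r * τ l = 0 := fun l hl => by
          simp [hρ0 l hl, hτ0 l hl]
        have hρ1' : ∑ l, ((1 - r) * ρ l + r * τ l) = 1 := by
          rw [Finset.sum_add_distrib, ← Finset.mul_sum, ← Finset.mul_sum, hρ1, hτ1]
          ring
        -- The new swap acts before the earlier rounds, so the induction hypothesis is used for the
        -- populations that this swap produces.
        have h := hpop _ hρ0' hρ1' l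
        rw [← (Equiv.sumArrowEquivProdArrow Q N Bool).symm.sum_comp, Fintype.sum_prod_type_right]
        simp only [permSeq, Equiv.coe_fn_symm_mk, qubitProb_sumElim, Sum.elim_comp_inl,
          Sum.elim_comp_inr]
        calc _ = ∑ z, (∑ b, ρ ((oneHotSwap f).symm ((π.symm (l, z)).1, b)).1 *
              qubitProb β w₀ ((oneHotSwap f).symm ((π.symm (l, z)).1, b)).2) *
              qubitProb β w (π.symm (l, z)).2 := by
              refine Finset.sum_congr rfl fun z _ => ?_
              rw [Finset.sum_mul]
              exact Finset.sum_congr rfl fun b _ => (mul_assoc _ _ _).symm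
          _ = (1 - r) ^ K * ((1 - r) * ρ l + r * τ l) + (1 - (1 - r) ^ K) * τ l := by
              rw [← h]
              exact Finset.sum_congr rfl fun z _ => by rw [hstep]
          _ = _ := by ring
  obtain ⟨K, hK⟩ := exists_pow_lt_of_lt_one hη (show 1 - r < 1 by linarith)
  obtain ⟨N, i1, i2, w, hwN, π, hπ, hpop⟩ := key K
  exact ⟨N, i1, i2, w, hwN, π, hπ, _, pow_nonneg (by linarith) K, hK.le, hpop⟩

end Thermalize

/-! ### Preparation of the thermal state, with removal of coherences -/

section Preparation

open scoped MatrixOrder Matrix.Norms.L2Operator in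
theorem Matrix.PosSemidef.exists_eq_conjTranspose_mul_self {n : Type*} [Fintype n]
    {A : Matrix n n ℂ} (hA : A.PosSemidef) : ∃ B : Matrix n n ℂ, A = Bᴴ * B := by
  classical exact CStarAlgebra.nonneg_iff_eq_star_mul_self.mp hA.nonneg

/-- In the Gram form `Bᴴ * B` the columns of `B` have squared norm at most the trace, and `x * y ≤
(x ^ 2 + y ^ 2) / 2` bounds their inner products. -/
theorem norm_apply_le_one {n : Type*} [Fintype n] {A : Matrix n n ℂ} (hA : IsDensityMatrix A)
    (i j : n) : ‖A i j‖ ≤ 1 := by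
  obtain ⟨B, hB⟩ := hA.1.exists_eq_conjTranspose_mul_self
  have hcol : ∀ j, ∑ k, ‖B k j‖ ^ 2 ≤ 1 := fun j => by
    have h1 : (∑ j, ∑ k, ‖B k j‖ ^ 2 : ℝ) = 1 := by
      have h2 : A.trace = ((∑ j, ∑ k, ‖B k j‖ ^ 2 : ℝ) : ℂ) := by
        simp [hB, Matrix.trace, Matrix.mul_apply, ← Complex.conj_mul']
      exact Complex.ofReal_injective (by rw [← h2, hA.2, Complex.ofReal_one])
    rw [← h1]
    exact Finset.single_le_sum (f := fun j => ∑ k, ‖B k j‖ ^ 2) (fun _ _ => by positivity)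
      (Finset.mem_univ j)
  calc ‖A i j‖ = ‖∑ k, star (B k i) * B k j‖ := by
        rw [hB, Matrix.mul_apply]
        rfl
    _ ≤ ∑ k, ‖star (B k i) * B k j‖ := norm_sum_le _ _
    _ ≤ ∑ k, (‖B k i‖ ^ 2 + ‖B k j‖ ^ 2) / 2 := by
        refine Finset.sum_le_sum fun k _ => ?_
        rw [norm_mul, norm_star]
        nlinarith [sq_nonneg (‖B k i‖ - ‖B k j‖)]
    _ = (∑ k, ‖B k i‖ ^ 2 + ∑ k, ‖B k j‖ ^ 2) / 2 := by
        rw [← Finset.sum_div, Finset.sum_add_distrib]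
    _ ≤ 1 := by linarith [hcol i, hcol j]

section SignedPerm

variable {x : Type*} [Fintype x] [DecidableEq x]

/-- The monomial matrix of the permutation `π` with the coefficients `s`. -/
def signedPerm (s : x → ℝ) (π : Equiv.Perm x) : Matrix x x ℂ :=
  Matrix.of fun a b => if a = π b then (s a : ℂ) else 0

/-- Diagonal entries go to diagonal entries, so with signs `±1` the final populations do not see the
initial coherences. -/
theorem signedPerm_conj_apply (s : x → ℝ) (π : Equiv.Perm x) (A : Matrix x x ℂ) (a b : x) :
    (signedPerm s π * A * (signedPerm s π)ᴴ) a b = s a * s b * A (π.symm a) (π.symm b) := by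
  have h : ∀ a b, (signedPerm s π) a b = if b = π.symm a then (s a : ℂ) else 0 := fun a b => by
    simp only [signedPerm, Matrix.of_apply, Equiv.eq_symm_apply, eq_comm]
  simp only [Matrix.mul_apply, Matrix.conjTranspose_apply, h, ite_mul, zero_mul,
    Finset.sum_ite_eq', Finset.mem_univ, if_true, apply_ite star, star_zero,
    mul_ite, mul_zero, RCLike.star_def, Complex.conj_ofReal]
  ring

theorem signedPerm_mem_unitaryGroup {s : x → ℝ} (hs : ∀ a, s a * s a = 1) (π : Equiv.Perm x) :
    signedPerm s π ∈ Matrix.unitaryGroup x ℂ := by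
  rw [Matrix.mem_unitaryGroup_iff, Matrix.star_eq_conjTranspose]
  ext a b
  have h1 := signedPerm_conj_apply s π 1 a b
  rw [Matrix.mul_one] at h1
  rw [h1]
  by_cases h : a = b
  · subst h
    rw [Matrix.one_apply_eq, Matrix.one_apply_eq, mul_one, ← Complex.ofReal_mul, hs,
      Complex.ofReal_one]
  · simp [h]

end SignedPerm

/-- The Hamiltonian of a qubit with excitation energy `w`. -/
noncomputable def qubitHam (w : ℝ) : Matrix Bool Bool ℂ :=
  Matrix.diagonal fun b => ((if b then w else 0 : ℝ) : ℂ)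

theorem qubitHam_eq_spectralMatrix (w : ℝ) :
    qubitHam w = spectralMatrix 1 fun b => if b then w else 0 := by
  simp [qubitHam, spectralMatrix]

/-- The mean energy of a qubit determines its populations. -/
theorem apply_self_of_mem_microstates_qubitHam {β w : ℝ} (hw : w ≠ 0) {σ : Matrix Bool Bool ℂ}
    (hσ : σ ∈ microstates (thermalEnergy β (qubitHam w)) (qubitHam w)) (b : Bool) :
    σ b b = qubitPop β w b := by
  have h1 : (1 : Matrix Bool Bool ℂ) ∈ Matrix.unitaryGroup Bool ℂ := one_mem _
  have he := hσ.2
  rw [thermalEnergy, qubitHam_eq_spectralMatrix, gibbs_spectralMatrix h1,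
    meanEnergy_spectralMatrix, meanEnergy_spectralMatrix, population_spectralMatrix h1] at he
  have htrue : population 1 σ true = qubitPop β w true := by
    simp only [Fintype.sum_bool, if_true, Bool.false_eq_true, if_false, mul_zero, add_zero] at he
    rw [mul_right_cancel₀ hw he]
    simp [boltzmann, qubitPop, add_comm]
  have hsum := hσ.1.sum_population h1
  rw [Fintype.sum_bool, htrue, ← qubitPop_true_add_false β w] at hsum
  have hpop : ∀ b, population 1 σ b = qubitPop β w b := fun b => by
    cases b
    · linarith
    · exact htrue
  rw [← hpop, hσ.1.ofReal_population]
  simp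

/-- The difference is `(1 - exp (-x)) / (1 + exp (-x))` at `x = β * w`, and `1 - exp (-x) ≤ x`. -/
theorem abs_qubitPop_sub_le {β w : ℝ} (h : 0 ≤ β * w) :
    |qubitPop β w false - qubitPop β w true| ≤ β * w := by
  have h1 := Real.add_one_le_exp (-(β * w))
  have h2 : Real.exp (-(β * w)) ≤ 1 := Real.exp_le_one_iff.2 (by linarith)
  have h3 := Real.exp_pos (-(β * w))
  simp only [qubitPop, if_true, Bool.false_eq_true, if_false, mul_zero, neg_zero, Real.exp_zero]
  rw [← sub_div, abs_of_nonneg (div_nonneg (by linarith) (by linarith)),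
    div_le_iff₀ (by linarith)]
  nlinarith

variable {m : Type*} [Fintype m] [DecidableEq m]

/-- The phase that the qubit `j` gives to the level `l`. -/
def dephasingSign {J : Type} [DecidableEq J] (g : m → J) (l : m) (j : J) (b : Bool) : ℝ :=
  if b = true ∧ j = g l then -1 else 1

theorem dephasingSign_mul_self {J : Type} [DecidableEq J] (g : m → J) (l : m) (j : J) (b : Bool) :
    dephasingSign g l j b * dephasingSign g l j b = 1 := by
  unfold dephasingSign
  split_ifs <;> norm_num

/-- The sum factors over the qubits. The qubit `g l` flips the sign of `l` but not of `l'`, so its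
factor is the small population difference; all other factors are at most one in modulus. -/
theorem abs_sum_dephasingSign_le {J : Type} [Fintype J] [DecidableEq J] {g : m → J}
    (hg : Function.Injective g) {l l' : m} (hl : l ≠ l') {β w : ℝ} (hw : 0 ≤ β * w) :
    |∑ y : J → Bool, ∏ j, (dephasingSign g l j (y j) * dephasingSign g l' j (y j) *
      qubitPop β w (y j))| ≤ β * w := by
  rw [sum_prod_bool fun j b =>
    dephasingSign g l j b * dephasingSign g l' j b * qubitPop β w b, Finset.abs_prod,
    ← Finset.mul_prod_erase _ _ (Finset.mem_univ (g l))]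
  have h1 := qubitPop_true_add_false β w
  have h2 := qubitPop_pos β w true
  have h3 := qubitPop_pos β w false
  have hne : g l ≠ g l' := fun h => hl (hg h)
  have hfirst : |dephasingSign g l (g l) true * dephasingSign g l' (g l) true *
      qubitPop β w true + dephasingSign g l (g l) false * dephasingSign g l' (g l) false *
      qubitPop β w false| ≤ β * w := by
    simp only [dephasingSign, hne, and_true, and_false, if_true, if_false, Bool.false_eq_true,
      mul_one, one_mul]
    convert abs_qubitPop_sub_le hw using 2
    ring
  have hrest : ∀ j, |dephasingSign g l j true * dephasingSign g l' j true *
      qubitPop β w true + dephasingSign g l j false * dephasingSign g l' j false *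
      qubitPop β w false| ≤ 1 := fun j => by
    rw [abs_le]
    simp only [dephasingSign, Bool.false_eq_true, false_and, if_false, true_and]
    split_ifs <;> constructor <;> nlinarith
  calc _ ≤ β * w * 1 := mul_le_mul hfirst
        (Finset.prod_le_one (fun _ _ => abs_nonneg _) fun j _ => hrest j)
        (Finset.prod_nonneg fun _ _ => abs_nonneg _) hw
    _ = β * w := mul_one _

/-- A system whose mean energy with respect to `k` is the thermal one can be brought, by a fixed
unitary on the system and qubits with thermal mean energies, as close as desired to the thermal
state, without changing the mean energy of the qubits. -/
theorem exists_preparation {Q : Type} [Fintype Q] [DecidableEq Q] [Nonempty Q] {β : ℝ}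
    (hβ : β ≠ 0) (f : Q ↪ m) (k τ : m → ℝ)
    (hτ : ∃ C, ∀ q, Real.exp (-(β * k (f q))) = C * τ (f q))
    (hτ0 : ∀ l ∉ Set.range f, τ l = 0) (hτ1 : ∑ l, τ l = 1) (hτp : ∀ l, 0 ≤ τ l)
    {η : ℝ} (hη : 0 < η) :
    ∃ (N : Type) (_ : Fintype N) (_ : DecidableEq N) (w : N → ℝ),
      ∃ M ∈ Matrix.unitaryGroup (m × (N → Bool)) ℂ, ∀ A : Matrix m m ℂ, IsDensityMatrix A →
        ∀ ρ : m → ℝ, (∀ l, A l l = ρ l) → (∀ l ∉ Set.range f, ρ l = 0) →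
        ∑ l, ρ l * k l = ∑ l, τ l * k l → ∀ σ : N → Matrix Bool Bool ℂ,
        (∀ i, σ i ∈ microstates (thermalEnergy β (qubitHam (w i))) (qubitHam (w i))) →
          (∀ l l', ‖partialTrace (M * (A ⊗ₖ tensorProd σ) * Mᴴ) l l' -
            Matrix.diagonal (fun l => (τ l : ℂ)) l l'‖ ≤ η) ∧
          meanEnergy ((1 : Matrix m m ℂ) ⊗ₖ
              Matrix.diagonal fun z => ((qubitEnergy w z : ℝ) : ℂ))
              (M * (A ⊗ₖ tensorProd σ) * Mᴴ) =
            meanEnergy (Matrix.diagonal fun z => ((qubitEnergy w z : ℝ) : ℂ)) (tensorProd σ) := by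
  -- Half of `η`, because the populations differ from `τ` by at most 2.
  obtain ⟨N, _, _, w, hw, π, hπ, a, ha0, haη, hpop⟩ :=
    exists_thermalizing_perm β f k τ hτ hτ0 hτ1 (half_pos hη)
  -- Coherences are first bounded by the number of configurations of the swap qubits; `δ`
  -- compensates this. The gap `v = δ / β` has the sign of `β`, so that `β * v = δ > 0`.
  set δ : ℝ := η / 2 ^ Fintype.card N with hδ
  have hδ0 : 0 < δ := by positivity
  set v : ℝ := δ / β with hv
  have hβv : β * v = δ := mul_div_cancel₀ δ hβ
  have hv0 : v ≠ 0 := div_ne_zero hδ0.ne' hβ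
  set g := Fintype.equivFin m with hg
  let J := Fin (Fintype.card m)
  set w' : N ⊕ J → ℝ := Sum.elim w fun _ => v with hw'
  have hw'0 : ∀ i, w' i ≠ 0 := by
    rintro (i | j)
    exacts [hw i, hv0]
  set s : m × (N ⊕ J → Bool) → ℝ :=
    fun x => ∏ j, dephasingSign g x.1 j (x.2 (Sum.inr j)) with hs
  set π' : Equiv.Perm (m × (N ⊕ J → Bool)) := permSeq π (Equiv.refl _) with hπ'
  have hs1 : ∀ x, s x * s x = 1 := fun x => by
    simp [hs, ← Finset.prod_mul_distrib, dephasingSign_mul_self]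
  refine ⟨N ⊕ J, inferInstance, inferInstance, w', signedPerm s π',
    signedPerm_mem_unitaryGroup hs1 π', fun A hA ρ hρ hρ0 hk σ hσ => ?_⟩
  have hρ1 : ∑ l, ρ l = 1 := by
    have := hA.2
    simp only [Matrix.trace, Matrix.diag, hρ] at this
    exact_mod_cast this
  have hσP : ∀ z, tensorProd σ z z = (qubitProb β w' z : ℂ) := fun z => by
    simp only [tensorProd, Matrix.of_apply, qubitProb, Complex.ofReal_prod]
    exact Finset.prod_congr rfl fun i _ =>
      apply_self_of_mem_microstates_qubitHam (hw'0 i) (hσ i) _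
  have hdiag : ∀ x : m × (N ⊕ J → Bool),
      (A ⊗ₖ tensorProd σ) x x = ((ρ x.1 * qubitProb β w' x.2 : ℝ) : ℂ) := fun x => by
    rw [Matrix.kroneckerMap_apply, hρ, hσP, Complex.ofReal_mul]
  have hpop' : ∀ l, ∑ z, ρ (π'.symm (l, z)).1 * qubitProb β w' (π'.symm (l, z)).2 =
      a * ρ l + (1 - a) * τ l := fun l => by
    rw [← hpop ρ hρ0 hρ1 l, ← (Equiv.sumArrowEquivProdArrow N J Bool).symm.sum_comp,
      Fintype.sum_prod_type]
    refine Finset.sum_congr rfl fun x _ => ?_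
    simp only [hπ', permSeq, Equiv.coe_fn_symm_mk, hw', qubitProb_sumElim, Sum.elim_comp_inl,
      Sum.elim_comp_inr]
    calc _ = ∑ y, ρ (π.symm (l, x)).1 * qubitProb β w (π.symm (l, x)).2 *
          qubitProb β (fun _ : J => v) y :=
          Finset.sum_congr rfl fun y _ => (mul_assoc _ _ _).symm
      _ = _ := by rw [← Finset.mul_sum, sum_qubitProb, mul_one]
  refine ⟨fun l l' => ?_, ?_⟩
  · by_cases hl : l = l'
    · subst hl
      have h1 : partialTrace (signedPerm s π' * (A ⊗ₖ tensorProd σ) * (signedPerm s π')ᴴ) l l =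
          ((a * ρ l + (1 - a) * τ l : ℝ) : ℂ) := by
        rw [← hpop', Complex.ofReal_sum, partialTrace, Matrix.of_apply]
        refine Finset.sum_congr rfl fun z _ => ?_
        rw [signedPerm_conj_apply, hdiag, ← Complex.ofReal_mul, hs1, Complex.ofReal_one, one_mul]
      have h2 : |ρ l - τ l| ≤ 2 := by
        have h3 : ‖A l l‖ ≤ 1 := norm_apply_le_one hA l l
        rw [hρ, Complex.norm_real, Real.norm_eq_abs] at h3
        have h4 : |τ l| ≤ 1 := by
          rw [abs_of_nonneg (hτp l), ← hτ1]
          exact Finset.single_le_sum (fun l _ => hτp l) (Finset.mem_univ l)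
        calc |ρ l - τ l| ≤ |ρ l| + |τ l| := abs_sub _ _
          _ ≤ 2 := by linarith
      rw [h1, Matrix.diagonal_apply_eq, ← Complex.ofReal_sub, Complex.norm_real,
        Real.norm_eq_abs, show a * ρ l + (1 - a) * τ l - τ l = a * (ρ l - τ l) by ring, abs_mul,
        abs_of_nonneg ha0]
      nlinarith [abs_nonneg (ρ l - τ l)]
    · rw [Matrix.diagonal_apply_ne _ hl, sub_zero]
      -- The dephasing qubits are not moved, so the partial trace meets only their diagonal entries,
      -- which are known. The unknown coherences of the swap qubits stay in the first factor.
      have h1 : partialTrace (signedPerm s π' * (A ⊗ₖ tensorProd σ) * (signedPerm s π')ᴴ) l l' =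
          (∑ x, A (π.symm (l, x)).1 (π.symm (l', x)).1 *
            tensorProd (fun i => σ (Sum.inl i)) (π.symm (l, x)).2 (π.symm (l', x)).2) *
          ((∑ y : J → Bool, ∏ j, (dephasingSign g l j (y j) * dephasingSign g l' j (y j) *
            qubitPop β v (y j)) : ℝ) : ℂ) := by
        rw [partialTrace, Matrix.of_apply, ← (Equiv.sumArrowEquivProdArrow N J Bool).symm.sum_comp,
          Fintype.sum_prod_type, Complex.ofReal_sum, Finset.sum_mul_sum]
        refine Finset.sum_congr rfl fun x _ => Finset.sum_congr rfl fun y _ => ?_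
        rw [signedPerm_conj_apply]
        have h2 : ∀ j, σ (Sum.inr j) (y j) (y j) = qubitPop β v (y j) := fun j =>
          apply_self_of_mem_microstates_qubitHam hv0 (hσ (Sum.inr j)) _
        simp only [hs, hπ', permSeq, Equiv.coe_fn_symm_mk, Matrix.kroneckerMap_apply, tensorProd,
          Matrix.of_apply, Fintype.prod_sum_type, Finset.prod_mul_distrib, Complex.ofReal_mul,
          Complex.ofReal_prod, ← h2]
        simp only [Equiv.sumArrowEquivProdArrow, Equiv.coe_fn_symm_mk, Sum.elim_inl, Sum.elim_inr,
          Sum.elim_comp_inl, Sum.elim_comp_inr, Equiv.refl_symm, Equiv.refl_apply]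
        ring
      rw [h1, norm_mul, Complex.norm_real, Real.norm_eq_abs]
      have h2 : ‖∑ x, A (π.symm (l, x)).1 (π.symm (l', x)).1 *
          tensorProd (fun i => σ (Sum.inl i)) (π.symm (l, x)).2 (π.symm (l', x)).2‖ ≤
          2 ^ Fintype.card N := by
        refine (norm_sum_le _ _).trans ?_
        calc _ ≤ ∑ _x : N → Bool, (1 : ℝ) := by
              refine Finset.sum_le_sum fun x _ => ?_
              rw [norm_mul]
              refine mul_le_one₀ (norm_apply_le_one hA _ _) (norm_nonneg _) ?_
              rw [tensorProd, Matrix.of_apply, norm_prod]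
              exact Finset.prod_le_one (fun _ _ => norm_nonneg _)
                fun i _ => norm_apply_le_one (hσ _).1 _ _
          _ = 2 ^ Fintype.card N := by simp
      have h3 := abs_sum_dephasingSign_le g.injective hl (hβv.symm ▸ hδ0.le : 0 ≤ β * v)
      rw [hβv] at h3
      calc _ ≤ 2 ^ Fintype.card N * δ := mul_le_mul h2 h3 (abs_nonneg _) (by positivity)
        _ = η := by
          rw [hδ]
          field_simp
  · have hcons : ∀ x, k (π' x).1 + qubitEnergy w' (π' x).2 = k x.1 + qubitEnergy w' x.2 := by
      intro x
      have := hπ (x.1, x.2 ∘ Sum.inl)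
      simp only [hπ', permSeq, Equiv.coe_fn_mk, hw', qubitEnergy_sumElim, Sum.elim_comp_inl,
        Sum.elim_comp_inr, Equiv.refl_apply]
      linarith
    have hone : (1 : Matrix m m ℂ) ⊗ₖ
        (Matrix.diagonal fun z => ((qubitEnergy w' z : ℝ) : ℂ)) =
        Matrix.diagonal fun x : m × (N ⊕ J → Bool) => ((qubitEnergy w' x.2 : ℝ) : ℂ) := by
      rw [← Matrix.diagonal_one, Matrix.diagonal_kronecker_diagonal]
      simp
    have hL : meanEnergy (Matrix.diagonal fun x : m × (N ⊕ J → Bool) =>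
        ((qubitEnergy w' x.2 : ℝ) : ℂ))
        (signedPerm s π' * (A ⊗ₖ tensorProd σ) * (signedPerm s π')ᴴ) =
        ∑ x, ρ (π'.symm x).1 * qubitProb β w' (π'.symm x).2 * qubitEnergy w' x.2 := by
      have : (signedPerm s π' * (A ⊗ₖ tensorProd σ) * (signedPerm s π')ᴴ *
          Matrix.diagonal fun x : m × (N ⊕ J → Bool) =>
            ((qubitEnergy w' x.2 : ℝ) : ℂ)).trace =
          ((∑ x, ρ (π'.symm x).1 * qubitProb β w' (π'.symm x).2 * qubitEnergy w' x.2 : ℝ) : ℂ) := by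
        rw [Matrix.trace, Complex.ofReal_sum]
        refine Finset.sum_congr rfl fun x _ => ?_
        rw [Matrix.diag_apply, Matrix.mul_diagonal, signedPerm_conj_apply, hdiag,
          ← Complex.ofReal_mul, hs1, Complex.ofReal_one, one_mul, ← Complex.ofReal_mul]
      rw [meanEnergy, this, Complex.ofReal_re]
    have hR : meanEnergy (Matrix.diagonal fun z => ((qubitEnergy w' z : ℝ) : ℂ)) (tensorProd σ) =
        ∑ z, qubitProb β w' z * qubitEnergy w' z := by
      rw [meanEnergy, Matrix.trace]
      simp only [Matrix.diag_apply, Matrix.mul_diagonal, hσP, ← Complex.ofReal_mul,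
        ← Complex.ofReal_sum, Complex.ofReal_re]
    have hbefore : ∑ x : m × (N ⊕ J → Bool), ρ x.1 * qubitProb β w' x.2 *
        (k x.1 + qubitEnergy w' x.2) =
        ∑ l, ρ l * k l + ∑ z, qubitProb β w' z * qubitEnergy w' z := by
      calc _ = ∑ x : m × (N ⊕ J → Bool), (ρ x.1 * k x.1) * qubitProb β w' x.2 +
            ∑ x : m × (N ⊕ J → Bool), ρ x.1 * (qubitProb β w' x.2 * qubitEnergy w' x.2) := by
            rw [← Finset.sum_add_distrib]
            exact Finset.sum_congr rfl fun x _ => by ring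
        _ = (∑ l, ρ l * k l) * (∑ z, qubitProb β w' z) +
            (∑ l, ρ l) * ∑ z, qubitProb β w' z * qubitEnergy w' z := by
            rw [Fintype.sum_prod_type, Fintype.sum_prod_type, Finset.sum_mul_sum,
              Finset.sum_mul_sum]
        _ = _ := by rw [sum_qubitProb, hρ1, mul_one, one_mul]
    -- The final populations mix `ρ` and `τ`, which have the same mean of `k`. Since `k` plus the
    -- qubit energy is conserved, the qubits keep their mean energy whatever `a` is.
    have hafter : ∑ x, ρ (π'.symm x).1 * qubitProb β w' (π'.symm x).2 * k x.1 =
        ∑ l, ρ l * k l := by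
      calc _ = ∑ l, (a * ρ l + (1 - a) * τ l) * k l := by
            rw [Fintype.sum_prod_type]
            refine Finset.sum_congr rfl fun l _ => ?_
            rw [← hpop', Finset.sum_mul]
        _ = a * ∑ l, ρ l * k l + (1 - a) * ∑ l, τ l * k l := by
            rw [Finset.mul_sum, Finset.mul_sum, ← Finset.sum_add_distrib]
            exact Finset.sum_congr rfl fun l _ => by ring
        _ = ∑ l, ρ l * k l := by
            rw [← hk]
            ring
    have hshift : ∑ x, ρ (π'.symm x).1 * qubitProb β w' (π'.symm x).2 *
        (k x.1 + qubitEnergy w' x.2) =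
        ∑ x : m × (N ⊕ J → Bool), ρ x.1 * qubitProb β w' x.2 *
        (k x.1 + qubitEnergy w' x.2) := by
      rw [← Equiv.sum_comp π']
      refine Finset.sum_congr rfl fun x _ => ?_
      rw [Equiv.symm_apply_apply, hcons]
    simp only [mul_add, Finset.sum_add_distrib] at hshift hbefore
    rw [hone, hL, hR]
    linarith

end Preparation

/-! ### Partial traces and local unitaries -/

section PartialTrace

variable {m z : Type*} [Fintype m] [DecidableEq m] [Fintype z] [DecidableEq z]

theorem partialTrace_conj_kronecker_one (T : Matrix m m ℂ) (X : Matrix (m × z) (m × z) ℂ) :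
    partialTrace ((T ⊗ₖ (1 : Matrix z z ℂ)) * X * (T ⊗ₖ (1 : Matrix z z ℂ))ᴴ) =
      T * partialTrace X * Tᴴ := by
  ext i j
  simp only [partialTrace, Matrix.of_apply, Matrix.mul_apply, Matrix.conjTranspose_apply,
    Matrix.kroneckerMap_apply, Fintype.sum_prod_type, Matrix.one_apply, mul_ite, mul_one, mul_zero,
    ite_mul, zero_mul, apply_ite star, star_zero, Finset.sum_ite_eq, Finset.mem_univ, if_true]
  simp only [Finset.sum_mul, Finset.mul_sum]
  rw [Finset.sum_comm]
  refine Finset.sum_congr rfl fun _ _ => ?_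
  rw [Finset.sum_comm]

theorem trace_mul_kronecker_one (X : Matrix (m × z) (m × z) ℂ) (K : Matrix m m ℂ) :
    (X * (K ⊗ₖ (1 : Matrix z z ℂ))).trace = (partialTrace X * K).trace := by
  simp only [Matrix.trace, Matrix.diag_apply, partialTrace, Matrix.of_apply, Matrix.mul_apply,
    Matrix.kroneckerMap_apply, Fintype.sum_prod_type, Matrix.one_apply, mul_ite, mul_one, mul_zero,
    Finset.sum_ite_eq', Finset.mem_univ, if_true, Finset.sum_mul]
  refine Finset.sum_congr rfl fun _ _ => ?_
  rw [Finset.sum_comm]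

theorem trace_conj_kronecker_one_mul {T : Matrix m m ℂ} (hT : Tᴴ * T = 1)
    (X : Matrix (m × z) (m × z) ℂ) (D : Matrix z z ℂ) :
    ((T ⊗ₖ (1 : Matrix z z ℂ)) * X * (T ⊗ₖ (1 : Matrix z z ℂ))ᴴ *
      ((1 : Matrix m m ℂ) ⊗ₖ D)).trace = (X * ((1 : Matrix m m ℂ) ⊗ₖ D)).trace := by
  rw [Matrix.mul_assoc, Matrix.mul_assoc, Matrix.trace_mul_comm, Matrix.mul_assoc,
    Matrix.conjTranspose_kronecker, Matrix.conjTranspose_one, ← Matrix.mul_kronecker_mul,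
    ← Matrix.mul_kronecker_mul]
  simp [hT]

theorem partialTrace_kronecker_assoc {n x y : Type*} [Fintype x] [Fintype y]
    (e : z ≃ x × y) (X : Matrix ((n × x) × y) ((n × x) × y) ℂ) :
    partialTrace (X.submatrix (((Equiv.refl n).prodCongr e).trans (Equiv.prodAssoc n x y).symm)
      (((Equiv.refl n).prodCongr e).trans (Equiv.prodAssoc n x y).symm)) =
      partialTrace (partialTrace X) := by
  ext i j
  simp only [partialTrace, Matrix.of_apply, Matrix.submatrix_apply]
  rw [← Fintype.sum_prod_type' (f := fun a b => X ((i, a), b) ((j, a), b)), ← e.sum_comp]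
  rfl

end PartialTrace

/-! ### Tensor products over finite families -/

section TensorProd

variable {ι : Type*} [Fintype ι] [DecidableEq ι] {X : ι → Type*} [∀ i, Fintype (X i)]
  [∀ i, DecidableEq (X i)]

theorem tensorProd_mul (A B : ∀ i, Matrix (X i) (X i) ℂ) :
    tensorProd A * tensorProd B = tensorProd fun i => A i * B i := by
  ext x y
  simp only [tensorProd, Matrix.mul_apply, Matrix.of_apply, ← Finset.prod_mul_distrib]
  rw [Finset.prod_univ_sum, Fintype.piFinset_univ]

theorem trace_tensorProd (A : ∀ i, Matrix (X i) (X i) ℂ) :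
    (tensorProd A).trace = ∏ i, (A i).trace := by
  simp only [tensorProd, Matrix.trace, Matrix.diag_apply, Matrix.of_apply]
  rw [Finset.prod_univ_sum, Fintype.piFinset_univ]

theorem conjTranspose_tensorProd (A : ∀ i, Matrix (X i) (X i) ℂ) :
    (tensorProd A)ᴴ = tensorProd fun i => (A i)ᴴ := by
  ext x y
  simp [tensorProd]

theorem tensorProd_diagonal (d : ∀ i, X i → ℂ) :
    tensorProd (fun i => Matrix.diagonal (d i)) = Matrix.diagonal fun x => ∏ i, d i (x i) := by
  ext x y
  by_cases h : x = y
  · subst h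
    simp [tensorProd]
  · obtain ⟨i, hi⟩ := Function.ne_iff.1 h
    rw [Matrix.diagonal_apply_ne _ h, tensorProd, Matrix.of_apply]
    exact Finset.prod_eq_zero (Finset.mem_univ i) (Matrix.diagonal_apply_ne _ hi)

theorem tensorProd_one :
    tensorProd (fun i => (1 : Matrix (X i) (X i) ℂ)) = 1 := by
  simp only [← Matrix.diagonal_one, tensorProd_diagonal, Finset.prod_const_one]

theorem sum_tensorProd_update_diagonal (d : ∀ i, X i → ℝ) :
    ∑ i, tensorProd (Function.update (fun j => (1 : Matrix (X j) (X j) ℂ)) i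
      (Matrix.diagonal fun a => (d i a : ℂ))) =
      Matrix.diagonal fun x => ((∑ i, d i (x i) : ℝ) : ℂ) := by
  have h : ∀ i, Function.update (fun j => (1 : Matrix (X j) (X j) ℂ)) i
      (Matrix.diagonal fun a => (d i a : ℂ)) = fun j => Matrix.diagonal
        (Function.update (fun j (_ : X j) => (1 : ℂ)) i (fun a => (d i a : ℂ)) j) := fun i => by
    ext1 j
    by_cases hj : j = i
    · subst hj
      simp
    · simp [hj]
  have h2 : ∀ i (x : ∀ i, X i), ∏ j, (Function.update (fun j (_ : X j) => (1 : ℂ)) i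
      (fun a => (d i a : ℂ)) j) (x j) = (d i (x i) : ℂ) := fun i x => by
    rw [Finset.prod_eq_single i]
    · simp
    · intro j _ hj
      simp [hj]
    · simp
  simp only [h, tensorProd_diagonal, h2]
  ext x y
  rw [Matrix.sum_apply]
  by_cases hxy : x = y
  · subst hxy
    simp
  · simp [hxy]

theorem tensorProd_mem_unitaryGroup {W : ∀ i, Matrix (X i) (X i) ℂ}
    (hW : ∀ i, W i ∈ Matrix.unitaryGroup (X i) ℂ) :
    tensorProd W ∈ Matrix.unitaryGroup (∀ i, X i) ℂ := by
  rw [Matrix.mem_unitaryGroup_iff, Matrix.star_eq_conjTranspose, conjTranspose_tensorProd,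
    tensorProd_mul]
  simp only [fun i => unitary_mul_conjTranspose (hW i), tensorProd_one]

theorem isDensityMatrix_tensorProd {σ : ∀ i, Matrix (X i) (X i) ℂ}
    (hσ : ∀ i, IsDensityMatrix (σ i)) : IsDensityMatrix (tensorProd σ) := by
  choose B hB using fun i => (hσ i).1.exists_eq_conjTranspose_mul_self
  refine ⟨?_, ?_⟩
  · have : tensorProd σ = (tensorProd B)ᴴ * tensorProd B := by
      rw [conjTranspose_tensorProd, tensorProd_mul]
      exact congrArg _ (funext hB)
    rw [this]
    exact Matrix.posSemidef_conjTranspose_mul_self _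
  · rw [trace_tensorProd]
    exact Finset.prod_eq_one fun i _ => (hσ i).2

theorem IsDensityMatrix.kronecker {m n : Type*} [Fintype m] [Fintype n] {A : Matrix m m ℂ}
    {B : Matrix n n ℂ} (hA : IsDensityMatrix A) (hB : IsDensityMatrix B) :
    IsDensityMatrix (A ⊗ₖ B) :=
  ⟨hA.1.kronecker hB.1, by rw [Matrix.trace_kronecker, hA.2, hB.2, one_mul]⟩

theorem tensorProd_spectralMatrix (W : ∀ i, Matrix (X i) (X i) ℂ) (p : ∀ i, X i → ℝ) :
    tensorProd (fun i => spectralMatrix (W i) (p i)) =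
      spectralMatrix (tensorProd W) fun x => ∏ i, p i (x i) := by
  simp only [spectralMatrix, ← tensorProd_mul, ← conjTranspose_tensorProd, tensorProd_diagonal,
    Complex.ofReal_prod]

theorem tensorProd_sum {ι' : Type*} [Fintype ι'] {Y : ι ⊕ ι' → Type*}
    (A : ∀ i, Matrix (Y i) (Y i) ℂ) :
    tensorProd A = (tensorProd (fun i => A (Sum.inl i)) ⊗ₖ
      tensorProd fun i => A (Sum.inr i)).submatrix
      (Equiv.sumPiEquivProdPi Y) (Equiv.sumPiEquivProdPi Y) := by
  ext x y
  simp [tensorProd, Fintype.prod_sum_type]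

theorem tensorProd_sum_update_inl {ι' : Type*} [Fintype ι'] [DecidableEq ι'] {Y : ι ⊕ ι' → Type*}
    [∀ i, Fintype (Y i)] [∀ i, DecidableEq (Y i)] (i : ι)
    (A : Matrix (Y (Sum.inl i)) (Y (Sum.inl i)) ℂ) :
    tensorProd (Function.update (fun j => (1 : Matrix (Y j) (Y j) ℂ)) (Sum.inl i) A) =
      (tensorProd (Function.update
        (fun j => (1 : Matrix (Y (Sum.inl j)) (Y (Sum.inl j)) ℂ)) i A) ⊗ₖ
      (1 : Matrix (∀ j, Y (Sum.inr j)) (∀ j, Y (Sum.inr j)) ℂ)).submatrix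
      (Equiv.sumPiEquivProdPi Y) (Equiv.sumPiEquivProdPi Y) := by
  rw [tensorProd_sum, ← tensorProd_one]
  congr 3
  ext1 j
  by_cases hj : j = i
  · subst hj
    simp
  · rw [Function.update_of_ne hj, Function.update_of_ne (by simpa using hj)]

theorem tensorProd_sum_update_inr {ι' : Type*} [Fintype ι'] [DecidableEq ι'] {Y : ι ⊕ ι' → Type*}
    [∀ i, Fintype (Y i)] [∀ i, DecidableEq (Y i)] (i : ι')
    (A : Matrix (Y (Sum.inr i)) (Y (Sum.inr i)) ℂ) :
    tensorProd (Function.update (fun j => (1 : Matrix (Y j) (Y j) ℂ)) (Sum.inr i) A) =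
      ((1 : Matrix (∀ j, Y (Sum.inl j)) (∀ j, Y (Sum.inl j)) ℂ) ⊗ₖ
      tensorProd (Function.update
        (fun j => (1 : Matrix (Y (Sum.inr j)) (Y (Sum.inr j)) ℂ)) i A)).submatrix
      (Equiv.sumPiEquivProdPi Y) (Equiv.sumPiEquivProdPi Y) := by
  rw [tensorProd_sum, ← tensorProd_one]
  congr 3
  ext1 j
  by_cases hj : j = i
  · subst hj
    simp
  · rw [Function.update_of_ne hj, Function.update_of_ne (by simpa using hj)]

theorem sum_tensorProd_update_sum {ι' : Type*} [Fintype ι'] [DecidableEq ι'] {Y : ι ⊕ ι' → Type*}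
    [∀ i, Fintype (Y i)] [∀ i, DecidableEq (Y i)] (A : ∀ i, Matrix (Y i) (Y i) ℂ) :
    ∑ i, tensorProd (Function.update (fun j => (1 : Matrix (Y j) (Y j) ℂ)) i (A i)) =
      ((∑ i, tensorProd (Function.update
        (fun j => (1 : Matrix (Y (Sum.inl j)) (Y (Sum.inl j)) ℂ)) i (A (Sum.inl i)))) ⊗ₖ
        (1 : Matrix (∀ j, Y (Sum.inr j)) (∀ j, Y (Sum.inr j)) ℂ) +
      (1 : Matrix (∀ j, Y (Sum.inl j)) (∀ j, Y (Sum.inl j)) ℂ) ⊗ₖ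
      ∑ i, tensorProd (Function.update
        (fun j => (1 : Matrix (Y (Sum.inr j)) (Y (Sum.inr j)) ℂ)) i (A (Sum.inr i)))).submatrix
      (Equiv.sumPiEquivProdPi Y) (Equiv.sumPiEquivProdPi Y) := by
  rw [Fintype.sum_sum_type]
  simp only [tensorProd_sum_update_inl, tensorProd_sum_update_inr]
  ext x y
  simp only [Matrix.submatrix_apply, Matrix.add_apply, Matrix.sum_apply, Matrix.kroneckerMap_apply,
    Finset.sum_mul, Finset.mul_sum]

end TensorProd

theorem kronecker_spectralMatrix {m n : Type*} [Fintype m] [Fintype n] [DecidableEq m]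
    [DecidableEq n] (V : Matrix m m ℂ) (W : Matrix n n ℂ) (g : m → ℝ) (p : n → ℝ) :
    spectralMatrix V g ⊗ₖ spectralMatrix W p =
      spectralMatrix (V ⊗ₖ W) fun x => g x.1 * p x.2 := by
  simp only [spectralMatrix, Matrix.conjTranspose_kronecker, Complex.ofReal_mul,
    Matrix.mul_kronecker_mul]
  rw [Matrix.diagonal_kronecker_diagonal]

/-! ### Energy of the compound, and environments enlarged by qubits -/

section Energy

variable {n : Type*} [Fintype n] [DecidableEq n] (E : Environment)

theorem meanEnergy_add (H K ρ : Matrix n n ℂ) :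
    meanEnergy (H + K) ρ = meanEnergy H ρ + meanEnergy K ρ := by
  simp [meanEnergy, Matrix.mul_add]

theorem Environment.meanEnergy_jointHam (H ρ : Matrix n n ℂ) (hρ : ρ.trace = 1)
    (σ : ∀ i, Matrix (E.X i) (E.X i) ℂ) (hσ : ∀ i, (σ i).trace = 1) :
    meanEnergy (E.jointHam H) (ρ ⊗ₖ tensorProd σ) =
      meanEnergy H ρ + ∑ i, meanEnergy (E.ham i) (σ i) := by
  rw [Environment.jointHam, meanEnergy_add]
  congr 1
  · rw [meanEnergy, meanEnergy, ← Matrix.mul_kronecker_mul, Matrix.trace_kronecker, Matrix.mul_one,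
      trace_tensorProd]
    simp [hσ]
  · rw [meanEnergy, ← Matrix.mul_kronecker_mul, Matrix.trace_kronecker, Matrix.mul_one, hρ, one_mul,
      Environment.totalHam, Finset.mul_sum, Matrix.trace_sum, Complex.re_sum]
    refine Finset.sum_congr rfl fun i _ => ?_
    rw [tensorProd_mul, trace_tensorProd, Finset.prod_eq_single i, Function.update_self, meanEnergy]
    · intro j _ hj
      rw [Function.update_of_ne hj, Matrix.mul_one, hσ]
    · simp

/-- All terms are diagonal in the product of the local eigenbases, where eigenvalues add. -/
theorem Environment.jointHam_eq_spectralMatrix {V : Matrix n n ℂ}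
    (hV : V ∈ Matrix.unitaryGroup n ℂ) (h : n → ℝ)
    {W : ∀ i, Matrix (E.X i) (E.X i) ℂ} (hW : ∀ i, W i ∈ Matrix.unitaryGroup (E.X i) ℂ)
    {k : ∀ i, E.X i → ℝ} (hk : ∀ i, E.ham i = spectralMatrix (W i) (k i)) :
    E.jointHam (spectralMatrix V h) =
      spectralMatrix (V ⊗ₖ tensorProd W) fun x => h x.1 + ∑ i, k i (x.2 i) := by
  have htot : E.totalHam = spectralMatrix (tensorProd W) fun x => ∑ i, k i (x i) := by
    rw [spectralMatrix, ← sum_tensorProd_update_diagonal, Finset.mul_sum, Finset.sum_mul,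
      Environment.totalHam]
    refine Finset.sum_congr rfl fun i _ => ?_
    rw [tensorProd_mul, conjTranspose_tensorProd, tensorProd_mul]
    congr 1
    ext1 j
    by_cases hj : j = i
    · subst hj
      simp only [Function.update_self]
      rw [hk, spectralMatrix]
    · simp only [Function.update_of_ne hj]
      rw [Matrix.mul_one, unitary_mul_conjTranspose (hW j)]
  have hone : ∀ {a : Type _} [Fintype a] [DecidableEq a] {V : Matrix a a ℂ},
      V ∈ Matrix.unitaryGroup a ℂ → (1 : Matrix a a ℂ) = spectralMatrix V fun _ => 1 := by
    intro a _ _ V hV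
    simp [spectralMatrix, unitary_mul_conjTranspose hV]
  have hone' : (1 : Matrix E.Basis E.Basis ℂ) = spectralMatrix (tensorProd W) fun _ => 1 := by
    simp [spectralMatrix, unitary_mul_conjTranspose (tensorProd_mem_unitaryGroup hW)]
  rw [Environment.jointHam, htot, hone', hone hV, kronecker_spectralMatrix,
    kronecker_spectralMatrix, spectralMatrix, spectralMatrix, spectralMatrix, ← Matrix.add_mul,
    ← Matrix.mul_add, Matrix.diagonal_add]
  simp

theorem isHermitian_qubitHam (w : ℝ) : (qubitHam w).IsHermitian :=
  Matrix.isHermitian_diagonal_of_self_adjoint _ <| by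
    ext b
    exact Complex.conj_ofReal _

/-- The environment `E` together with qubits of excitation energies `w`. -/
noncomputable def Environment.addQubits {N : Type} [Fintype N] [DecidableEq N] (w : N → ℝ) :
    Environment where
  ι := E.ι ⊕ N
  X := Sum.elim E.X fun _ => Bool
  fintypeBasis := Sum.rec (fun i => E.fintypeBasis i) fun _ => inferInstanceAs (Fintype Bool)
  decEqBasis := Sum.rec (fun i => E.decEqBasis i) fun _ => inferInstanceAs (DecidableEq Bool)
  nonemptyBasis := Sum.rec (fun i => E.nonemptyBasis i) fun _ => inferInstanceAs (Nonempty Bool)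
  ham := Sum.rec (fun i => E.ham i) fun i => qubitHam (w i)
  isHermitian_ham := Sum.rec (fun i => E.isHermitian_ham i) fun i => isHermitian_qubitHam (w i)

/-- The separation of the basis labels of the added qubits. -/
def Environment.addQubitsEquiv {N : Type} [Fintype N] [DecidableEq N] (w : N → ℝ) :
    (E.addQubits w).Basis ≃ E.Basis × (N → Bool) :=
  Equiv.sumPiEquivProdPi (Sum.elim E.X fun _ => Bool)

/-- The separation of the basis labels of the added qubits, for the compound with a system. -/
def Environment.jointAddQubitsEquiv (n : Type*) {N : Type} [Fintype N] [DecidableEq N]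
    (w : N → ℝ) : n × (E.addQubits w).Basis ≃ (n × E.Basis) × (N → Bool) :=
  ((Equiv.refl n).prodCongr (E.addQubitsEquiv w)).trans (Equiv.prodAssoc _ _ _).symm

variable {N : Type} [Fintype N] [DecidableEq N] (w : N → ℝ)

theorem Environment.tensorProd_addQubits
    (σ : ∀ i, Matrix ((E.addQubits w).X i) ((E.addQubits w).X i) ℂ) :
    tensorProd σ = (tensorProd (X := E.X) (fun i => σ (Sum.inl i)) ⊗ₖ
      tensorProd (X := fun _ : N => Bool) fun i => σ (Sum.inr i)).submatrix
        (E.addQubitsEquiv w) (E.addQubitsEquiv w) :=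
  tensorProd_sum (Y := Sum.elim E.X fun _ => Bool) σ

theorem Environment.kronecker_tensorProd_addQubits (ρ : Matrix n n ℂ)
    (σ : ∀ i, Matrix ((E.addQubits w).X i) ((E.addQubits w).X i) ℂ) :
    ρ ⊗ₖ tensorProd σ = ((ρ ⊗ₖ tensorProd (X := E.X) (fun i => σ (Sum.inl i))) ⊗ₖ
      tensorProd (X := fun _ : N => Bool) fun i => σ (Sum.inr i)).submatrix
        (E.jointAddQubitsEquiv n w) (E.jointAddQubitsEquiv n w) := by
  rw [E.tensorProd_addQubits w]
  ext x y
  exact (mul_assoc _ _ _).symm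

theorem Environment.totalHam_addQubits :
    (E.addQubits w).totalHam = (E.totalHam ⊗ₖ (1 : Matrix (N → Bool) (N → Bool) ℂ) +
      (1 : Matrix E.Basis E.Basis ℂ) ⊗ₖ
        Matrix.diagonal fun z => ((qubitEnergy w z : ℝ) : ℂ)).submatrix
        (E.addQubitsEquiv w) (E.addQubitsEquiv w) := by
  have hq : (Matrix.diagonal fun z : N → Bool => ((qubitEnergy w z : ℝ) : ℂ)) =
      ∑ i, tensorProd (Function.update (fun _ => (1 : Matrix Bool Bool ℂ)) i (qubitHam (w i))) :=
    (sum_tensorProd_update_diagonal (X := fun _ : N => Bool)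
      fun i b => if b then w i else 0).symm
  rw [hq]
  exact @sum_tensorProd_update_sum E.ι _ _ N _ _ (E.addQubits w).X (E.addQubits w).fintypeBasis
    (E.addQubits w).decEqBasis (E.addQubits w).ham

theorem Environment.jointHam_addQubits (H : Matrix n n ℂ) :
    (E.addQubits w).jointHam H = (E.jointHam H ⊗ₖ (1 : Matrix (N → Bool) (N → Bool) ℂ) +
      (1 : Matrix (n × E.Basis) (n × E.Basis) ℂ) ⊗ₖ
        Matrix.diagonal fun z => ((qubitEnergy w z : ℝ) : ℂ)).submatrix
        (E.jointAddQubitsEquiv n w) (E.jointAddQubitsEquiv n w) := by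
  have h1 : (1 : Matrix (E.addQubits w).Basis (E.addQubits w).Basis ℂ) =
      ((1 : Matrix E.Basis E.Basis ℂ) ⊗ₖ (1 : Matrix (N → Bool) (N → Bool) ℂ)).submatrix
        (E.addQubitsEquiv w) (E.addQubitsEquiv w) := by
    rw [Matrix.one_kronecker_one, Matrix.submatrix_one_equiv]
  rw [Environment.jointHam, Environment.jointHam, E.totalHam_addQubits w, h1,
    Matrix.add_kronecker, ← Matrix.one_kronecker_one]
  ext x y
  simp only [Matrix.add_apply, Matrix.submatrix_apply, Matrix.kroneckerMap_apply,
    Environment.jointAddQubitsEquiv, Equiv.trans_apply, Equiv.prodCongr_apply, Prod.map_fst,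
    Prod.map_snd, Equiv.prodAssoc_symm_apply, Equiv.refl_apply]
  ring

end Energy

/-! ### Conversion between microstate and macrostate operations -/

section Reachability

theorem exists_entrywise_ball {m : Type*} [Fintype m] {D₀ : Matrix m m ℂ}
    {s : Set (Matrix m m ℂ)} (hs : s ∈ 𝓝 D₀) :
    ∃ η > 0, ∀ D : Matrix m m ℂ, (∀ i j, ‖D i j - D₀ i j‖ ≤ η) → D ∈ s := by
  obtain ⟨η, hη, h⟩ := Metric.mem_nhds_iff (α := m → m → ℂ).1 hs
  refine ⟨η / 2, half_pos hη, fun D hD => h ?_⟩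
  refine lt_of_le_of_lt ?_ (half_lt_self hη)
  refine (dist_pi_le_iff (half_pos hη).le).2 fun i =>
    (dist_pi_le_iff (half_pos hη).le).2 fun j => ?_
  rw [dist_eq_norm]
  exact hD i j

theorem submatrix_equiv_mem_unitaryGroup {a b : Type*} [Fintype a] [DecidableEq a] [Fintype b]
    [DecidableEq b] (g : a ≃ b) {V : Matrix b b ℂ} (hV : V ∈ Matrix.unitaryGroup b ℂ) :
    V.submatrix g g ∈ Matrix.unitaryGroup a ℂ := by
  rw [Matrix.mem_unitaryGroup_iff, Matrix.star_eq_conjTranspose, Matrix.conjTranspose_submatrix,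
    Matrix.submatrix_mul_equiv, unitary_mul_conjTranspose hV, Matrix.submatrix_one_equiv]

theorem conj_submatrix_equiv {a b : Type*} [Fintype a] [Fintype b] (g : a ≃ b)
    (V A : Matrix b b ℂ) :
    V.submatrix g g * A.submatrix g g * (V.submatrix g g)ᴴ = (V * A * Vᴴ).submatrix g g := by
  rw [Matrix.conjTranspose_submatrix, Matrix.submatrix_mul_equiv, Matrix.submatrix_mul_equiv]

theorem meanEnergy_submatrix_equiv {a b : Type*} [Fintype a] [Fintype b] (g : a ≃ b)
    (K A : Matrix b b ℂ) :
    meanEnergy (K.submatrix g g) (A.submatrix g g) = meanEnergy K A := by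
  rw [meanEnergy, meanEnergy, Matrix.submatrix_mul_equiv]
  congr 1
  exact g.sum_comp fun i => (A * K) i i

variable {n : Type*} [Fintype n] [DecidableEq n]

theorem conj_kronecker_one {m z : Type*} [Fintype m] [Fintype z] [DecidableEq z]
    (W R : Matrix m m ℂ) (σ : Matrix z z ℂ) :
    (Wᴴ ⊗ₖ (1 : Matrix z z ℂ)) * (R ⊗ₖ σ) * (Wᴴ ⊗ₖ (1 : Matrix z z ℂ))ᴴ = (Wᴴ * R * W) ⊗ₖ σ := by
  rw [Matrix.conjTranspose_kronecker, ← Matrix.mul_kronecker_mul, ← Matrix.mul_kronecker_mul]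
  simp

theorem exists_stable_ball {x : Type*} [Fintype x] (T K D₀ : Matrix (n × x) (n × x) ℂ) {δ ε : ℝ}
    (hδ : 0 < δ) (hε : 0 < ε) :
    ∃ η > 0, ∀ D : Matrix (n × x) (n × x) ℂ, (∀ i j, ‖D i j - D₀ i j‖ ≤ η) →
      (∀ i j, ‖partialTrace (T * D * Tᴴ) i j - partialTrace (T * D₀ * Tᴴ) i j‖ < δ) ∧
      |meanEnergy K (T * D * Tᴴ) - meanEnergy K (T * D₀ * Tᴴ)| < ε := by
  have hcont : Continuous fun D : Matrix (n × x) (n × x) ℂ => T * D * Tᴴ := by fun_prop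
  have hcont1 : ∀ i j, Continuous fun D : Matrix (n × x) (n × x) ℂ =>
      partialTrace (T * D * Tᴴ) i j := fun i j =>
    continuous_finsetSum _ fun k _ => hcont.matrix_elem (i, k) (j, k)
  have hcont2 : Continuous fun D : Matrix (n × x) (n × x) ℂ => meanEnergy K (T * D * Tᴴ) :=
    Complex.continuous_re.comp (hcont.matrix_mul continuous_const).matrix_trace
  refine exists_entrywise_ball (s := {D | _}) (Filter.Eventually.and ?_ ?_)
  · refine eventually_all.2 fun i => eventually_all.2 fun j => ?_
    refine ((hcont1 i j).sub continuous_const).norm.continuousAt.eventually_lt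
      continuousAt_const ?_
    simpa using hδ
  · refine (hcont2.sub continuous_const).abs.continuousAt.eventually_lt continuousAt_const ?_
    simpa using hε

/-- System and environment energies are fixed separately, so the total stays independent of the
microstates after the system Hamiltonian is rescaled by `c`. -/
theorem microstates_jointHam_energy {E : Environment} {β e : ℝ} {V : Matrix n n ℂ}
    (hV : V ∈ Matrix.unitaryGroup n ℂ) {h : n → ℝ}
    {W : ∀ i, Matrix (E.X i) (E.X i) ℂ} (hW : ∀ i, W i ∈ Matrix.unitaryGroup (E.X i) ℂ)
    {k : ∀ i, E.X i → ℝ} (hk : ∀ i, E.ham i = spectralMatrix (W i) (k i)) (c : ℝ)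
    {ρ : Matrix n n ℂ} (hρ : ρ ∈ microstates e (spectralMatrix V h))
    {σ : ∀ i, Matrix (E.X i) (E.X i) ℂ}
    (hσ : ∀ i, σ i ∈ microstates (thermalEnergy β (E.ham i)) (E.ham i)) :
    ∑ x, population (V ⊗ₖ tensorProd W) (ρ ⊗ₖ tensorProd σ) x *
      (c * h x.1 + ∑ i, k i (x.2 i)) = c * e + ∑ i, thermalEnergy β (E.ham i) := by
  have h1 := E.jointHam_eq_spectralMatrix hV (fun l => c * h l) hW hk
  rw [← meanEnergy_spectralMatrix, ← h1, E.meanEnergy_jointHam _ _ hρ.1.2 _ fun i => (hσ i).1.2,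
    meanEnergy_spectralMatrix, ← hρ.2, meanEnergy_spectralMatrix, Finset.mul_sum]
  congr 1
  · exact Finset.sum_congr rfl fun l _ => by ring
  · exact Finset.sum_congr rfl fun i _ => (hσ i).2

theorem population_kronecker_eq_zero {m : Type*} [Fintype m] [DecidableEq m] {V ρ : Matrix n n ℂ}
    (hρ : IsDensityMatrix ρ) (W σ : Matrix m m ℂ) {x : n × m} (h : population V ρ x.1 = 0) :
    population (V ⊗ₖ W) (ρ ⊗ₖ σ) x = 0 := by
  rw [population, Matrix.conjTranspose_kronecker, ← Matrix.mul_kronecker_mul,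
    ← Matrix.mul_kronecker_mul, Matrix.kroneckerMap_apply, ← hρ.ofReal_population, h]
  simp

theorem gibbs_mem_microstates {m : Type*} [Fintype m] [DecidableEq m] [Nonempty m]
    {K : Matrix m m ℂ} (hK : K.IsHermitian) (β : ℝ) :
    gibbs β K ∈ microstates (thermalEnergy β K) K :=
  ⟨isDensityMatrix_gibbs hK β, rfl⟩

theorem MacReachable.micReachable {β e : ℝ} {H γ ρf : Matrix n n ℂ} (hγ : γ ∈ microstates e H)
    (h : MacReachable β e H ρf) : MicReachable β H γ ρf := by
  intro ε hε ε' hε'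
  obtain ⟨E, U, hU, hE⟩ := h ε hε ε' hε'
  exact ⟨E, U, hU, hE γ hγ _ fun i => gibbs_mem_microstates (E.isHermitian_ham i) β⟩

/-- Where the microstates and the thermal environment have a common Gibbs distribution, a
microstate operation can be preceded by a preparation of that distribution. -/
theorem MicReachable.macReachable {β : ℝ} (hβ : β ≠ 0) {e b : ℝ} {V : Matrix n n ℂ}
    (hV : V ∈ Matrix.unitaryGroup n ℂ) {h p : n → ℝ} {L : Set n}
    (hp : ∃ C, ∀ l ∈ L, Real.exp (-(b * h l)) = C * p l)
    (hL : ∀ ρ ∈ microstates e (spectralMatrix V h), ∀ l ∉ L, population V ρ l = 0)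
    (hγ : spectralMatrix V p ∈ microstates e (spectralMatrix V h)) {ρf : Matrix n n ℂ}
    (hmic : MicReachable β (spectralMatrix V h) (spectralMatrix V p) ρf) :
    MacReachable β e (spectralMatrix V h) ρf := by
  intro ε hε ε' hε'
  obtain ⟨δ, hδ, hδε⟩ := exists_forall_traceNorm_le (n := n) hε
  obtain ⟨E, U, hU, hfin, hen⟩ := hmic (δ / 2) (half_pos hδ) (ε' / 2) (half_pos hε')
  set H := spectralMatrix V h with hH
  choose W hW k hk using fun i => (E.isHermitian_ham i).exists_spectralMatrix
  have hG : ∀ i, gibbs β (E.ham i) = spectralMatrix (W i) (boltzmann β (k i)) := fun i => by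
    rw [hk, gibbs_spectralMatrix (hW i)]
  set W' := V ⊗ₖ tensorProd W
  have hW' : W' ∈ Matrix.unitaryGroup (n × E.Basis) ℂ :=
    Matrix.kronecker_mem_unitary hV (tensorProd_mem_unitaryGroup hW)
  set τ : n × E.Basis → ℝ := fun x => p x.1 * ∏ i, boltzmann β (k i) (x.2 i)
  set Ω := spectralMatrix V p ⊗ₖ tensorProd (fun i => gibbs β (E.ham i)) with hΩ
  have hΩτ : Ω = spectralMatrix W' τ := by
    simp only [hΩ, hG]
    rw [tensorProd_spectralMatrix, kronecker_spectralMatrix]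
  have hthermal : ∀ i, gibbs β (E.ham i) ∈ microstates (thermalEnergy β (E.ham i)) (E.ham i) :=
    fun i => gibbs_mem_microstates (E.isHermitian_ham i) β
  have hΩd : IsDensityMatrix Ω :=
    hγ.1.kronecker (isDensityMatrix_tensorProd fun i => (hthermal i).1)
  have hτpop : population W' Ω = τ := by rw [hΩτ, population_spectralMatrix hW']
  have hτ1 : ∑ x, τ x = 1 := by rw [← hτpop, hΩd.sum_population hW']
  have hτp : ∀ x, 0 ≤ τ x := fun x => hτpop ▸ hΩd.population_nonneg x
  let S := {x : n × E.Basis // x.1 ∈ L}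
  let _ : Fintype S := Fintype.ofFinite S
  -- The joint levels whose system part lies in `L`: all products of microstates are carried by
  -- them.
  let f : Fin (Fintype.card S) ↪ n × E.Basis :=
    (Fintype.equivFin S).symm.toEmbedding.trans (Function.Embedding.subtype _)
  have hf : ∀ q, (f q).1 ∈ L := fun q => ((Fintype.equivFin S).symm q).2
  have hrange : ∀ x ∉ Set.range f, x.1 ∉ L := fun x hx hxL =>
    hx ⟨Fintype.equivFin S ⟨x, hxL⟩, by
      simp only [f, Function.Embedding.trans_apply, Equiv.coe_toEmbedding, Equiv.symm_apply_apply]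
      rfl⟩
  have hzero : ∀ ρ ∈ microstates e H, ∀ σ : Matrix E.Basis E.Basis ℂ, ∀ x ∉ Set.range f,
      population W' (ρ ⊗ₖ σ) x = 0 := fun ρ hρ σ x hx =>
    population_kronecker_eq_zero hρ.1 _ _ (hL ρ hρ _ (hrange x hx))
  have hτ0 : ∀ x ∉ Set.range f, τ x = 0 := fun x hx => hτpop ▸ hzero _ hγ _ x hx
  have hne : Nonempty (Fin (Fintype.card S)) := by
    by_contra hempty
    have : ∀ x, τ x = 0 := fun x => hτ0 x fun ⟨q, _⟩ => hempty ⟨q⟩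
    simp [this] at hτ1
  -- With the factor `b / β`, the distribution `τ` is proportional to `exp (-(β * K))` on `range f`.
  -- This is where `β ≠ 0` is needed for the system.
  set K : n × E.Basis → ℝ := fun x => b / β * h x.1 + ∑ i, k i (x.2 i) with hK
  have hprop : ∃ C, ∀ q, Real.exp (-(β * K (f q))) = C * τ (f q) := by
    obtain ⟨C, hC⟩ := hp
    refine ⟨C * ∏ i, ∑ y, Real.exp (-(β * k i y)), fun q => ?_⟩
    have h1 : -(β * K (f q)) = -(b * h (f q).1) + ∑ i, -(β * k i ((f q).2 i)) := by
      simp only [hK, mul_add, Finset.mul_sum, Finset.sum_neg_distrib]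
      field_simp
      ring
    have h2 : ∀ i, Real.exp (-(β * k i ((f q).2 i))) =
        (∑ y, Real.exp (-(β * k i y))) * boltzmann β (k i) ((f q).2 i) := fun i => by
      rw [boltzmann, mul_div_cancel₀]
      positivity
    rw [h1, Real.exp_add, Real.exp_sum, hC _ (hf q), Finset.prod_congr rfl fun i _ => h2 i,
      Finset.prod_mul_distrib]
    ring
  set T := U * W' with hT
  have hTu : T ∈ Matrix.unitaryGroup (n × E.Basis) ℂ := mul_mem hU hW'
  set D₀ : Matrix (n × E.Basis) (n × E.Basis) ℂ := Matrix.diagonal fun x => (τ x : ℂ) with hD₀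
  have hTD : T * D₀ * Tᴴ = U * Ω * Uᴴ := by
    rw [hΩτ, spectralMatrix, hT, Matrix.conjTranspose_mul]
    simp only [Matrix.mul_assoc]
    rfl
  obtain ⟨η, hη, hball⟩ := exists_stable_ball T (E.jointHam H) D₀ (half_pos hδ) (half_pos hε')
  obtain ⟨N, _, _, w, M, hM, hprep⟩ := exists_preparation hβ f K τ hprop hτ0 hτ1 hτp hη
  set I₂ := (1 : Matrix (N → Bool) (N → Bool) ℂ)
  set g := E.jointAddQubitsEquiv n w with hg
  -- Pass to the energy eigenbasis, prepare `τ` with the qubits, then return to the original basis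
  -- and apply `U`; the last two are combined in `T`.
  set Y := (T ⊗ₖ I₂) * M * (W'ᴴ ⊗ₖ I₂) with hY
  have hYu : Y ∈ Matrix.unitaryGroup ((n × E.Basis) × (N → Bool)) ℂ :=
    mul_mem (mul_mem (Matrix.kronecker_mem_unitary hTu (one_mem _)) hM)
      (Matrix.kronecker_mem_unitary (Unitary.star_mem hW') (one_mem _))
  refine ⟨E.addQubits w, Y.submatrix g g, submatrix_equiv_mem_unitaryGroup g hYu,
    fun ρ hρ σ hσ => ?_⟩
  set σE : ∀ i, Matrix (E.X i) (E.X i) ℂ := fun i => σ (Sum.inl i)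
  set σN : N → Matrix Bool Bool ℂ := fun i => σ (Sum.inr i)
  have hσE : ∀ i, σE i ∈ microstates (thermalEnergy β (E.ham i)) (E.ham i) :=
    fun i => hσ (Sum.inl i)
  have hσN : ∀ i, σN i ∈ microstates (thermalEnergy β (qubitHam (w i))) (qubitHam (w i)) :=
    fun i => hσ (Sum.inr i)
  set R := ρ ⊗ₖ tensorProd σE with hR
  have hRd : IsDensityMatrix R :=
    hρ.1.kronecker (isDensityMatrix_tensorProd fun i => (hσE i).1)
  have hinit : ρ ⊗ₖ tensorProd σ = (R ⊗ₖ tensorProd σN).submatrix g g :=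
    E.kronecker_tensorProd_addQubits w ρ σ
  obtain ⟨hclose, hqubits⟩ := hprep (W'ᴴ * R * W') (hRd.conj hW') (population W' R)
    (fun x => (hRd.ofReal_population x).symm) (hzero ρ hρ _)
    (by rw [hR, microstates_jointHam_energy hV hW hk (b / β) hρ hσE, ← hτpop, hΩ,
          microstates_jointHam_energy hV hW hk (b / β) hγ hthermal]) σN hσN
  set Z := M * ((W'ᴴ * R * W') ⊗ₖ tensorProd σN) * Mᴴ with hZ
  obtain ⟨hout, henergy⟩ := hball (partialTrace Z) hclose
  have hfinal : Y * (R ⊗ₖ tensorProd σN) * Yᴴ = (T ⊗ₖ I₂) * Z * (T ⊗ₖ I₂)ᴴ := by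
    rw [hZ, ← conj_kronecker_one W' R (tensorProd σN), hY]
    simp only [Matrix.conjTranspose_mul, Matrix.mul_assoc]
    rfl
  have hTT : Tᴴ * T = 1 := unitary_conjTranspose_mul hTu
  -- The preparation conserves the modified energy, not the true one. The true energy is compared
  -- only between the initial state and the target, which share all local mean energies.
  have hRΩ : meanEnergy (E.jointHam H) R = meanEnergy (E.jointHam H) Ω := by
    rw [hR, hΩ, E.meanEnergy_jointHam _ _ hρ.1.2 _ fun i => (hσE i).1.2,
      E.meanEnergy_jointHam _ _ hγ.1.2 _ fun i => (hthermal i).1.2, hρ.2, hγ.2]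
    congr 1
    exact Finset.sum_congr rfl fun i _ => (hσE i).2.trans (hthermal i).2.symm
  have hσNtr : (tensorProd σN).trace = 1 := (isDensityMatrix_tensorProd fun i => (hσN i).1).2
  rw [hTD] at hout henergy
  rw [Achieves, hinit, conj_submatrix_equiv, E.jointHam_addQubits w, meanEnergy_submatrix_equiv,
    meanEnergy_submatrix_equiv, hfinal]
  refine ⟨hδε _ fun i j => ?_, ?_⟩
  · have h1 : partialTrace (((T ⊗ₖ I₂) * Z * (T ⊗ₖ I₂)ᴴ).submatrix g g) =
        partialTrace (T * partialTrace Z * Tᴴ) := by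
      rw [← partialTrace_conj_kronecker_one]
      exact partialTrace_kronecker_assoc (E.addQubitsEquiv w) _
    rw [h1]
    have h2 := (norm_apply_le_traceNorm _ i j).trans hfin
    have h3 := hout i j
    rw [Matrix.sub_apply] at h2 ⊢
    rw [norm_sub_rev] at h3
    calc _ ≤ ‖ρf i j - partialTrace (U * Ω * Uᴴ) i j‖ + ‖partialTrace (U * Ω * Uᴴ) i j -
          partialTrace (T * partialTrace Z * Tᴴ) i j‖ := norm_sub_le_norm_sub_add_norm_sub _ _ _
      _ ≤ δ := by linarith
  · have h1 : meanEnergy (E.jointHam H ⊗ₖ I₂) ((T ⊗ₖ I₂) * Z * (T ⊗ₖ I₂)ᴴ) =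
        meanEnergy (E.jointHam H) (T * partialTrace Z * Tᴴ) := by
      rw [meanEnergy, trace_mul_kronecker_one, partialTrace_conj_kronecker_one, meanEnergy]
    have h2 : meanEnergy (E.jointHam H ⊗ₖ I₂) (R ⊗ₖ tensorProd σN) =
        meanEnergy (E.jointHam H) R := by
      rw [meanEnergy, ← Matrix.mul_kronecker_mul, Matrix.trace_kronecker, Matrix.mul_one, hσNtr,
        mul_one, meanEnergy]
    have h3 : ∀ D : Matrix (N → Bool) (N → Bool) ℂ,
        meanEnergy ((1 : Matrix (n × E.Basis) (n × E.Basis) ℂ) ⊗ₖ D)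
          ((T ⊗ₖ I₂) * Z * (T ⊗ₖ I₂)ᴴ) =
        meanEnergy ((1 : Matrix (n × E.Basis) (n × E.Basis) ℂ) ⊗ₖ D) Z := fun D => by
      rw [meanEnergy, trace_conj_kronecker_one_mul hTT, meanEnergy]
    have h4 : ∀ D : Matrix (N → Bool) (N → Bool) ℂ,
        meanEnergy ((1 : Matrix (n × E.Basis) (n × E.Basis) ℂ) ⊗ₖ D) (R ⊗ₖ tensorProd σN) =
        meanEnergy D (tensorProd σN) := fun D => by
      rw [meanEnergy, ← Matrix.mul_kronecker_mul, Matrix.trace_kronecker, Matrix.mul_one, hRd.2,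
        one_mul, meanEnergy]
    -- The qubit contributions cancel exactly. What remains is the cost of `U` on the thermal
    -- product and the deviation from it, at most `ε' / 2` each.
    rw [meanEnergy_add, meanEnergy_add, h1, h2, h3, h4, hqubits, hRΩ]
    rw [abs_le] at hen ⊢
    rw [abs_lt] at henergy
    constructor <;> linarith [hen.1, hen.2, henergy.1, henergy.2]

end Reachability

/-! ### Equivalence with the canonical ensemble -/

theorem theorem1 {n : Type*} [Fintype n] [DecidableEq n] (β : ℝ) (hβ : β ≠ 0)
    (H : Matrix n n ℂ) (hH : H.IsHermitian) (e : ℝ) (he : (microstates e H).Nonempty) :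
    (∃ γ : Matrix n n ℂ, IsCanonicalEnsemble e H γ) ∧
      ∀ γ : Matrix n n ℂ, IsCanonicalEnsemble e H γ → OperationallyEquivalent β e H γ := by
  refine ⟨exists_isCanonicalEnsemble hH he, fun γ hγ ρf _ => ?_⟩
  have : Nonempty n := by
    obtain ⟨ρ, hρ⟩ := he
    by_contra hn
    rw [not_nonempty_iff] at hn
    simpa [Matrix.trace] using hρ.1.2
  have hγm : γ ∈ microstates e H := ⟨hγ.isDensityMatrix hH, hγ.1⟩
  refine ⟨fun h => h.micReachable hγm, fun h => ?_⟩
  obtain ⟨V, hV, h', rfl⟩ := hH.exists_spectralMatrix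
  obtain ⟨b, L, p, rfl, hp, hL⟩ := hγ.exists_populations hV
  exact h.macReachable hβ hV hp hL hγm
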